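/- **Setting.** All spaces are real. A triple $(V,H,j)$ is an evolution triple if $V$ is a reflexive Banach space, $H$ a Hilbert space and $j\colon V\to H$ is linear, bounded, injective with dense range. Let $I=(0,T)$, $0<T<\infty$, $1<p\le q<\infty$, $p'=p/(p-1)$. Let $(V,H,j)$ and $(X_n,Y,j)$, $n\in\mathbb N$, be evolution triples with $H\subseteq Y$, $(\cdot,\cdot)_H=(\cdot,\cdot)_Y$ on $H$, $V\subseteq X_n$, $\|\cdot\|_V=\|\cdot\|_{X_n}$ on $V$, the maps $j$ agreeing on $V$, and $\|jx\|_Y\le c_Y\|x\|_{X_n}$ for all $x\in X_n$, with $c_Y>0$ independent of $n$. Write $L^p(I,E)\cap_jL^\infty(I,Y)$ for the set of $v\in L^p(I,E)$ with $jv\in L^\infty(I,Y)$, with the sum norm $\|v\|_{L^p(I,E)}+\|jv\|_{L^\infty(I,Y)}$. Let $V_n\subseteq X_n$ be closed subspaces, and assume the following. *Spaces.* (NC.1) There is a dense $D\subseteq V$ such that each $v\in D$ admits $v_n\in V_n$ with $\|v_n-v\|_{X_n}\to0$. (NC.2) If $m_k\to\infty$ and $v_k\in L^p(I,V_{m_k})\cap_jL^\infty(I,Y)$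 satisfy $\sup_k\|v_k\|_{L^p(I,X_{m_k})\cap_jL^\infty(I,Y)}<\infty$, then there is $v\in L^p(I,V)\cap_jL^\infty(I,H)$ such that a subsequence of $(jv_k)$ converges to $jv$ weakly-$*$ in $L^\infty(I,Y)$. *Initial data.* $v_0\in H$, $v_n^0\in V_n$, $jv_n^0\to v_0$ in $Y$ and $\sup_n\|jv_n^0\|_Y\le\|v_0\|_H$. *Right-hand sides.* $f\in L^{p'}(I,V^*)$, $f_n\in L^{p'}(I,X_n^*)$. (BN.1) $\sup_n\|f_n\|_{L^{p'}(I,X_n^*)}<\infty$. (BN.2) If $m_k\to\infty$, $v_k\in L^p(I,V_{m_k})\cap_jL^\infty(I,Y)$ is bounded in $L^p(I,X_{m_k})\cap_jL^\infty(I,Y)$, $v\in L^p(I,V)\cap_jL^\infty(I,H)$ and $jv_k\to jv$ weakly-$*$ in $L^\infty(I,Y)$, then $\int_I\langle f_{m_k}(s),v_k(s)\rangle_{X_{m_k}}\,ds\to\int_I\langle f(s),v(s)\rangle_V\,ds$. *Operators.* $A(t)\colon V\to V^*$ and $A_n(t)\colon X_n\to X_n^*$, $t\in I$, satisfy: - (A.1)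 $A(t)$ is demi-continuous (strongly convergent sequences are mapped to weakly convergent ones, with the corresponding limits) for a.e. $t$. (A.2) $t\mapsto A(t)v$ is Bochner measurable for every $v\in V$. (A.3) There is $\gamma\ge0$ with $|\langle A(t)v,w\rangle_V|\le\gamma[1+\|jv\|_H^q+\|v\|_V^p+\|jw\|_H^q+\|w\|_V^p]$ for a.e. $t$ and all $v,w\in V$. - (AN.1) For a.e. $t$, every $A_n(t)$ is demi-continuous, and $(A_n(t))_n$ is non-conforming pseudo-monotone with respect to $(V_n)_n$ and $A(t)$: if $m_k\to\infty$, $v_k\in V_{m_k}$, $\sup_k\|v_k\|_{X_{m_k}}<\infty$, $v\in V$, $jv_k\rightharpoonup jv$ in $Y$ and $\limsup_k\langle A_{m_k}(t)v_k,v_k-v\rangle_{X_{m_k}}\le0$, then $\langle A(t)v,v-w\rangle_V\le\liminf_k\langle A_{m_k}(t)v_k,v_k-w\rangle_{X_{m_k}}$ for all $w\in V$. (AN.2) $t\mapsto A_n(t)x$ is Bochner measurable for every $n$ and $x\in X_n$. - (AN.3) There are $c_0>0$, $c_1,c_2\ge0$, independent of $n$, with $\langle A_n(t)v,v\rangle_{X_n}\ge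 c_0\|v\|_{X_n}^p-c_1\|jv\|_Y^2-c_2$ for a.e. $t$ and all $v\in V_n$. (AN.4) There are $\gamma\ge0$, $\lambda\in(0,c_0)$, independent of $n$, with $|\langle A_n(t)x,y\rangle_{X_n}|\le\lambda\|x\|_{X_n}^p+\gamma[1+\|jx\|_Y^q+\|jy\|_Y^q+\|y\|_{X_n}^p]$ for a.e. $t$ and all $x,y\in X_n$. - (AN.5) For a.e. $t$ and every $n$, the restriction $B=(\mathrm{id}_{V_n})^*\circ A_n(t)\circ\mathrm{id}_{V_n}\colon V_n\to V_n^*$ is pseudo-monotone: $u_k\rightharpoonup u$ in $V_n$ and $\limsup_k\langle Bu_k,u_k-u\rangle_{V_n}\le0$ imply $\langle Bu,u-w\rangle_{V_n}\le\liminf_k\langle Bu_k,u_k-w\rangle_{V_n}$ for all $w\in V_n$. For $K\ge1$, $\tau=T/K$ and $k=1,\dots,K$ let $I_k^\tau=((k-1)\tau,k\tau]$, $[f_n]_k^\tau=\frac1\tau\int_{I_k^\tau}f_n(s)\,ds$ and $[A_n]_k^\tau x=\frac1\tau\int_{I_k^\tau}A_n(s)x\,ds$ for $x\in X_n$ (Bochner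 integrals in $X_n^*$). **Proposition (well-posedness of the scheme).** Set $\tau_0=\frac1{4c_1}$ ($\tau_0=\infty$ if $c_1=0$). For all $K\ge1$ and $n\in\mathbb N$ with $\tau=T/K<\tau_0$ there exist $v_n^1,\dots,v_n^K\in V_n$ which, with the given $v_n^0$, solve the implicit non-conforming Rothe–Galerkin scheme $$\Big(\frac{jv_n^k-jv_n^{k-1}}{\tau},jw\Big)_Y+\langle[A_n]_k^\tau v_n^k,w\rangle_{X_n}=\langle[f_n]_k^\tau,w\rangle_{X_n}\qquad\text{for all }w\in V_n,\ k=1,\dots,K,$$ all Bochner integrals in the scheme being well defined. -/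

import Mathlib

open Filter Topology MeasureTheory Set
open scoped ENNReal NNReal

namespace RotheGalerkin

/-! ### Banach space notions -/

/-- A normed space is reflexive if the canonical map into its bidual is onto. -/
def IsReflexiveSpace (E : Type*) [NormedAddCommGroup E] [NormedSpace ℝ E] : Prop :=
  Function.Surjective (NormedSpace.inclusionInDoubleDual ℝ E)

/-- `(V, H, j)` is an evolution triple: `V` is a reflexive Banach space, `H` is a Hilbert space and
`j : V → H` is a dense embedding, i.e. linear, bounded, injective and with dense range. -/
structure IsEvolutionTriple {V H : Type*} [NormedAddCommGroup V] [NormedSpace ℝ V] [CompleteSpace V]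
    [NormedAddCommGroup H] [InnerProductSpace ℝ H] [CompleteSpace H] (j : V →L[ℝ] H) : Prop where
  reflexive : IsReflexiveSpace V
  injective : Function.Injective j
  dense : DenseRange j

/-- Weak convergence of a sequence in a normed space. -/
def WeakTendsto {E : Type*} [NormedAddCommGroup E] [NormedSpace ℝ E] (u : ℕ → E) (x : E) : Prop :=
  ∀ φ : StrongDual ℝ E, Tendsto (fun k => φ (u k)) atTop (𝓝 (φ x))

/-- `A : E → E*` is demi-continuous: `xₖ → x` in `E` implies `A xₖ ⇀ A x` weakly in `E*`. -/
def IsDemicontinuous {E : Type*} [NormedAddCommGroup E] [NormedSpace ℝ E]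
    (A : E → StrongDual ℝ E) : Prop :=
  ∀ (u : ℕ → E) (x : E), Tendsto u atTop (𝓝 x) → WeakTendsto (fun k => A (u k)) (A x)

/-- `A : E → E*` is pseudo-monotone: from `uₖ ⇀ x` and `limsup ⟨A uₖ, uₖ - x⟩ ≤ 0` it follows that
`⟨A x, x - w⟩ ≤ liminf ⟨A uₖ, uₖ - w⟩` for all `w`.  The limits are taken in `[-∞, ∞]`. -/
def IsPseudoMonotone {E : Type*} [NormedAddCommGroup E] [NormedSpace ℝ E]
    (A : E → StrongDual ℝ E) : Prop :=
  ∀ (u : ℕ → E) (x : E), WeakTendsto u x →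
    limsup (fun k => ((A (u k) (u k - x) : ℝ) : EReal)) atTop ≤ 0 →
    ∀ w : E, ((A x (x - w) : ℝ) : EReal) ≤
      liminf (fun k => ((A (u k) (u k - w) : ℝ) : EReal)) atTop

/-- The restriction `(id_S)* ∘ A ∘ id_S : S → S*` of `A : E → E*` to a subspace `S`. -/
def restrictOperator {E : Type*} [NormedAddCommGroup E] [NormedSpace ℝ E] (S : Submodule ℝ E)
    (A : E → StrongDual ℝ E) : S → StrongDual ℝ S :=
  fun x => (A (x : E)).comp S.subtypeL

/-! ### Bochner-Lebesgue spaces on `I = (0, T)`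

Elements of `L^p(I, E)` are represented by functions `u : ℝ → E` with
`MemLp u p (timeMeasure T)`. -/

/-- Lebesgue measure on `I = (0, T)`. -/
noncomputable abbrev timeMeasure (T : ℝ) : Measure ℝ := volume.restrict (Ioo 0 T)

/-- The Hölder conjugate exponent `p' = p / (p - 1)`, as an extended nonnegative real. -/
noncomputable def dualExponent (p : ℝ) : ℝ≥0∞ := ENNReal.ofReal (p / (p - 1))

/-- `u ∈ L^p(I, E) ∩_j L^∞(I, Y)`, i.e. `u ∈ L^p(I, E)` and `j u ∈ L^∞(I, Y)`. -/
def MemLpInterLinfty {E Y : Type*} [NormedAddCommGroup E] [NormedSpace ℝ E]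
    [NormedAddCommGroup Y] [InnerProductSpace ℝ Y] (T p : ℝ) (j : E → Y) (u : ℝ → E) : Prop :=
  MemLp u (ENNReal.ofReal p) (timeMeasure T) ∧ MemLp (fun t => j (u t)) ∞ (timeMeasure T)

/-- The norm `‖u‖_{L^p(I, E)} + ‖j u‖_{L^∞(I, Y)}` of `L^p(I, E) ∩_j L^∞(I, Y)`. -/
noncomputable def normLpInterLinfty {E Y : Type*} [NormedAddCommGroup E] [NormedSpace ℝ E]
    [NormedAddCommGroup Y] [InnerProductSpace ℝ Y] (T p : ℝ) (j : E → Y) (u : ℝ → E) : ℝ≥0∞ :=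
  eLpNorm u (ENNReal.ofReal p) (timeMeasure T) + eLpNorm (fun t => j (u t)) ∞ (timeMeasure T)

/-- Weak-* convergence in `L^∞(I, Y) = (L^1(I, Y))*` for a Hilbert space `Y` (with `Y*` identified
with `Y`), tested with all `g ∈ L^1(I, Y)`. -/
def WeakStarTendsto {Y : Type*} [NormedAddCommGroup Y] [InnerProductSpace ℝ Y] (T : ℝ)
    (u : ℕ → ℝ → Y) (v : ℝ → Y) : Prop :=
  ∀ g : ℝ → Y, Integrable g (timeMeasure T) →
    Tendsto (fun k => ∫ t, inner ℝ (u k t) (g t) ∂(timeMeasure T)) atTop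
      (𝓝 (∫ t, inner ℝ (v t) (g t) ∂(timeMeasure T)))

/-! ### Non-conforming approximations -/

section Nonconforming

variable {V H Y : Type*} {X : ℕ → Type*}
  [NormedAddCommGroup V] [NormedSpace ℝ V] [CompleteSpace V]
  [NormedAddCommGroup H] [InnerProductSpace ℝ H] [CompleteSpace H]
  [NormedAddCommGroup Y] [InnerProductSpace ℝ Y] [CompleteSpace Y]
  [∀ n, NormedAddCommGroup (X n)] [∀ n, NormedSpace ℝ (X n)] [∀ n, CompleteSpace (X n)]

/-- `(V, H, j)` and `(X n, Y, j)` are evolution triples with `H ⊆ Y` and `V ⊆ X n`.  The inclusions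
are the linear isometries `iH : H → Y` (so that `(·,·)_H = (·,·)_Y` on `H`) and `iX n : V → X n`
(so that `‖·‖_V = ‖·‖_{X n}` on `V`); the maps `jV : V → H` and `jX n : X n → Y`, which carry the
same name `j` in the mathematical notation, agree on `V`.  Moreover
`‖j x‖_Y ≤ c_Y ‖x‖_{X n}` with `c_Y` independent of `n`. -/
structure IsNonconformingSetting (jV : V →L[ℝ] H) (jX : ∀ n, X n →L[ℝ] Y)
    (iH : H →ₗᵢ[ℝ] Y) (iX : ∀ n, V →ₗᵢ[ℝ] X n) : Prop where
  triple_V : IsEvolutionTriple jV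
  triple_X : ∀ n, IsEvolutionTriple (jX n)
  compatible : ∀ n (v : V), jX n (iX n v) = iH (jV v)
  bound : ∃ cY : ℝ, 0 < cY ∧ ∀ n (x : X n), ‖jX n x‖ ≤ cY * ‖x‖

/-- The closed subspaces `Vn n ⊆ X n` form a Bochner non-conforming approximation of `V` with
respect to `(X n)`.  A "cofinal subset of `ℕ`" is given by its increasing enumeration `φ`. -/
structure IsBochnerNonconformingApproximation (T p : ℝ) (jV : V →L[ℝ] H) (jX : ∀ n, X n →L[ℝ] Y)
    (iH : H →ₗᵢ[ℝ] Y) (iX : ∀ n, V →ₗᵢ[ℝ] X n) (Vn : ∀ n, Submodule ℝ (X n)) : Prop where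
  isClosed : ∀ n, IsClosed (Vn n : Set (X n))
  nc1 : ∃ D : Set V, Dense D ∧ ∀ v ∈ D, ∃ u : ∀ n, Vn n,
    Tendsto (fun n => ‖(u n : X n) - iX n v‖) atTop (𝓝 0)
  nc2 : ∀ (m : ℕ → ℕ) (u : ∀ k, ℝ → Vn (m k)), Tendsto m atTop atTop →
    (∀ k, MemLpInterLinfty T p (fun x : Vn (m k) => jX (m k) x) (u k)) →
    (⨆ k, normLpInterLinfty T p (fun x : Vn (m k) => jX (m k) x) (u k)) < ∞ →
    ∃ (φ : ℕ → ℕ) (v : ℝ → V), StrictMono φ ∧ MemLpInterLinfty T p jV v ∧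
      WeakStarTendsto T (fun k t => jX (m (φ k)) (u (φ k) t)) (fun t => iH (jV (v t)))

/-- The sequence `A n : X n → (X n)*` is non-conforming pseudo-monotone with respect to `(Vn n)` and
`A∞ : V → V*`. -/
def IsNonconformingPseudoMonotone (jV : V →L[ℝ] H) (jX : ∀ n, X n →L[ℝ] Y)
    (iH : H →ₗᵢ[ℝ] Y) (iX : ∀ n, V →ₗᵢ[ℝ] X n) (Vn : ∀ n, Submodule ℝ (X n))
    (A : ∀ n, X n → StrongDual ℝ (X n)) (Ainf : V → StrongDual ℝ V) : Prop :=
  ∀ (m : ℕ → ℕ) (u : ∀ k, Vn (m k)) (v : V), Tendsto m atTop atTop →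
    (∃ C : ℝ, ∀ k, ‖(u k : X (m k))‖ ≤ C) →
    WeakTendsto (fun k => jX (m k) (u k)) (iH (jV v)) →
    limsup (fun k => ((A (m k) (u k) ((u k : X (m k)) - iX (m k) v) : ℝ) : EReal)) atTop ≤ 0 →
    ∀ w : V, ((Ainf v (v - w) : ℝ) : EReal) ≤
      liminf (fun k => ((A (m k) (u k) ((u k : X (m k)) - iX (m k) w) : ℝ) : EReal)) atTop

/-! ### The standing assumption -/

/-- The conditions on the family `A(t) : V → V*`, `t ∈ I`: demi-continuity, Bochner measurability
and growth. -/
structure LimitOperatorConditions (T p q : ℝ) (jV : V →L[ℝ] H)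
    (A : ℝ → V → StrongDual ℝ V) : Prop where
  a1 : ∀ᵐ t ∂(timeMeasure T), IsDemicontinuous (A t)
  a2 : ∀ v : V, AEStronglyMeasurable (fun t => A t v) (timeMeasure T)
  a3 : ∃ γ : ℝ, 0 ≤ γ ∧ ∀ᵐ t ∂(timeMeasure T), ∀ v w : V,
    |A t v w| ≤ γ * (1 + ‖jV v‖ ^ q + ‖v‖ ^ p + ‖jV w‖ ^ q + ‖w‖ ^ p)

/-- The conditions on the families `An n t : X n → (X n)*`, `t ∈ I`, with the constants
`c₀, c₁, c₂` of the lower bound `an3`. -/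
structure DiscreteOperatorConditions (T p q c₀ c₁ c₂ : ℝ) (jV : V →L[ℝ] H)
    (jX : ∀ n, X n →L[ℝ] Y) (iH : H →ₗᵢ[ℝ] Y) (iX : ∀ n, V →ₗᵢ[ℝ] X n)
    (Vn : ∀ n, Submodule ℝ (X n)) (An : ∀ n, ℝ → X n → StrongDual ℝ (X n))
    (A : ℝ → V → StrongDual ℝ V) : Prop where
  an1_demicontinuous : ∀ᵐ t ∂(timeMeasure T), ∀ n, IsDemicontinuous (An n t)
  an1_pseudoMonotone : ∀ᵐ t ∂(timeMeasure T),
    IsNonconformingPseudoMonotone jV jX iH iX Vn (fun n => An n t) (A t)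
  an2 : ∀ n (x : X n), AEStronglyMeasurable (fun t => An n t x) (timeMeasure T)
  c₀_pos : 0 < c₀
  c₁_nonneg : 0 ≤ c₁
  c₂_nonneg : 0 ≤ c₂
  an3 : ∀ᵐ t ∂(timeMeasure T), ∀ n, ∀ v ∈ Vn n,
    c₀ * ‖v‖ ^ p - c₁ * ‖jX n v‖ ^ 2 - c₂ ≤ An n t v v
  an4 : ∃ γ lam : ℝ, 0 ≤ γ ∧ 0 < lam ∧ lam < c₀ ∧
    ∀ᵐ t ∂(timeMeasure T), ∀ n, ∀ x y : X n,
      |An n t x y| ≤ lam * ‖x‖ ^ p + γ * (1 + ‖jX n x‖ ^ q + ‖jX n y‖ ^ q + ‖y‖ ^ p)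
  an5 : ∀ᵐ t ∂(timeMeasure T), ∀ n, IsPseudoMonotone (restrictOperator (Vn n) (An n t))

/-- The standing assumption on spaces, initial data, right-hand sides and operators. -/
structure StandingAssumption (T p q c₀ c₁ c₂ : ℝ) (jV : V →L[ℝ] H)
    (jX : ∀ n, X n →L[ℝ] Y) (iH : H →ₗᵢ[ℝ] Y) (iX : ∀ n, V →ₗᵢ[ℝ] X n)
    (Vn : ∀ n, Submodule ℝ (X n)) (v₀ : H) (v₀n : ∀ n, Vn n)
    (f : ℝ → StrongDual ℝ V) (fn : ∀ n, ℝ → StrongDual ℝ (X n))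
    (A : ℝ → V → StrongDual ℝ V) (An : ∀ n, ℝ → X n → StrongDual ℝ (X n)) : Prop where
  T_pos : 0 < T
  one_lt_p : 1 < p
  p_le_q : p ≤ q
  setting : IsNonconformingSetting jV jX iH iX
  approximation : IsBochnerNonconformingApproximation T p jV jX iH iX Vn
  initial_tendsto : Tendsto (fun n => jX n (v₀n n)) atTop (𝓝 (iH v₀))
  initial_bound : ∀ n, ‖jX n (v₀n n)‖ ≤ ‖v₀‖
  f_memLp : MemLp f (dualExponent p) (timeMeasure T)
  fn_memLp : ∀ n, MemLp (fn n) (dualExponent p) (timeMeasure T)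
  bn1 : (⨆ n, eLpNorm (fn n) (dualExponent p) (timeMeasure T)) < ∞
  bn2 : ∀ (m : ℕ → ℕ) (u : ∀ k, ℝ → Vn (m k)) (v : ℝ → V), Tendsto m atTop atTop →
    (∀ k, MemLpInterLinfty T p (fun x : Vn (m k) => jX (m k) x) (u k)) →
    (⨆ k, normLpInterLinfty T p (fun x : Vn (m k) => jX (m k) x) (u k)) < ∞ →
    MemLpInterLinfty T p jV v →
    WeakStarTendsto T (fun k t => jX (m k) (u k t)) (fun t => iH (jV (v t))) →
    Tendsto (fun k => ∫ t, fn (m k) t (u k t) ∂(timeMeasure T)) atTop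
      (𝓝 (∫ t, f t (v t) ∂(timeMeasure T)))
  limitOperator : LimitOperatorConditions T p q jV A
  discreteOperator : DiscreteOperatorConditions T p q c₀ c₁ c₂ jV jX iH iX Vn An A

end Nonconforming

/-! ### The scheme -/

/-- The `k`-th time interval `I_k^τ = ((k - 1) τ, k τ]`. -/
def timeInterval (τ : ℝ) (k : ℕ) : Set ℝ := Ioc (((k : ℝ) - 1) * τ) ((k : ℝ) * τ)

/-- The `k`-th temporal mean `[g]_k^τ`, i.e. the Bochner mean value of `g` over `I_k^τ`. -/
noncomputable def temporalMean {E : Type*} [NormedAddCommGroup E] [NormedSpace ℝ E] (τ : ℝ) (k : ℕ)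
    (g : ℝ → E) : E :=
  ⨍ s in timeInterval τ k, g s

/-- The `k`-th temporal mean `[A]_k^τ : E → E*` of a family of operators, defined pointwise. -/
noncomputable def operatorMean {E : Type*} [NormedAddCommGroup E] [NormedSpace ℝ E] (τ : ℝ) (k : ℕ)
    (A : ℝ → E → StrongDual ℝ E) : E → StrongDual ℝ E :=
  fun x => temporalMean τ k (fun s => A s x)

/-- The backward difference quotient `d_τ uᵏ = (uᵏ - uᵏ⁻¹) / τ`, for `k ≥ 1`. -/
noncomputable def backwardDiff {E : Type*} [NormedAddCommGroup E] [NormedSpace ℝ E] (τ : ℝ)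
    (u : ℕ → E) (k : ℕ) : E :=
  τ⁻¹ • (u k - u (k - 1))

/-- `v 1, …, v K ∈ S` are iterates of the implicit Rothe-Galerkin scheme in the subspace `S ⊆ E`
with initial value `v 0 = a` and step size `τ = T / K`.  The Bochner integrals in the temporal means
are required to exist.  Values `v k` with `k > K` are irrelevant. -/
structure IsRotheGalerkinSolution {E Y : Type*} [NormedAddCommGroup E] [NormedSpace ℝ E]
    [NormedAddCommGroup Y] [InnerProductSpace ℝ Y] (T : ℝ) (K : ℕ) (j : E →L[ℝ] Y)
    (S : Submodule ℝ E) (a : S) (f : ℝ → StrongDual ℝ E) (A : ℝ → E → StrongDual ℝ E)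
    (v : ℕ → S) : Prop where
  initial : v 0 = a
  integrable_rhs : ∀ k, 1 ≤ k → k ≤ K → IntegrableOn f (timeInterval (T / K) k)
  integrable_operator : ∀ k, 1 ≤ k → k ≤ K →
    IntegrableOn (fun s => A s (v k : E)) (timeInterval (T / K) k)
  scheme : ∀ k, 1 ≤ k → k ≤ K → ∀ w ∈ S,
    inner ℝ (backwardDiff (T / K) (fun i => j (v i)) k) (j w)
        + operatorMean (T / K) k A (v k : E) w
      = temporalMean (T / K) k f w

/-- The step size bound `τ₀ = 1 / (4 c₁) ∈ (0, ∞]`, with `τ₀ = ∞` for `c₁ = 0`. -/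
noncomputable def tauZero (c₁ : ℝ) : ℝ≥0∞ := 1 / (4 * ENNReal.ofReal c₁)

end RotheGalerkin

/-!
Every step of the scheme is a stationary problem in the reflexive space `Vn n`: for the probability
measure `ν` that averages over the time interval, find `u` such that
`τ⁻¹ (j u, j w) + ⟨∫ A s u ∂ν, w⟩ = ⟨b, w⟩` for all `w`.  As `τ⁻¹ ≥ c₁`, the lower bound for `A`
makes the operator on the left coercive, and the growth condition makes it bounded on bounded sets
and the Bochner integrals convergent.  The iterates are then chosen recursively.

The average of a family of pseudo-monotone operators behaves like a pseudo-monotone operator along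
bounded sequences (`integral_apply_sub_le_of_isPseudoMonotone`): for almost every `s` the lower
limit of `⟨A s uₙ, uₙ - x⟩` is nonnegative, so if the integrals tend to zero, then so does the
integrand in `L¹` and, along a subsequence, almost everywhere, where pseudo-monotonicity of `A s`
applies.

Coercive operators of this kind have a zero by Galerkin approximation
(`IsDemicontinuous.exists_eq_zero`).  The finite-dimensional equations are solved by
`exists_zero_of_inner_pos`, a form of Brouwer's theorem, proved from the nonexistence of a `C¹`
retraction onto the sphere (`false_of_retraction`) by the argument of Milnor and Rogers: for a
retraction `r`, the integral of `det (1 + t (Dr - 1))` over the ball is a polynomial in `t` which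
equals the volume of the ball for small `t` and vanishes at `t = 1`.

The space is not assumed to be separable while pseudo-monotonicity is a sequential notion.
Therefore the Galerkin spaces exhaust only a separable closed subspace `S`, chosen such that the
values of the operator on `S` are determined by their restrictions to `S`
(`IsDemicontinuous.exists_separable_submodule`).  Bounded sequences in `S` have weakly convergent
subsequences, because `S` is reflexive and separable.
-/

namespace RotheGalerkin

/-! ### Zeros of continuous vector fields pointing outwards on a sphere -/

section Brouwer

open Metric Polynomial

/-- The value at `1` of a real polynomial of degree at most `d` is a fixed linear combination of its
values at finitely many points near `0`. -/
theorem exists_eval_one_eq_sum (d : ℕ) {t₀ : ℝ} (ht₀ : 0 < t₀) :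
    ∃ (s : Finset ℝ) (c : ℝ → ℝ), (∀ t ∈ s, t ∈ Ioo 0 t₀) ∧
      ∀ P : ℝ[X], P.natDegree ≤ d → P.eval 1 = ∑ t ∈ s, c t * P.eval t := by
  classical
  have hinj : Function.Injective fun i : ℕ => t₀ / (i + 2 : ℝ) := by
    intro i j hij
    have h1 : (i : ℝ) + 2 ≠ 0 := by positivity
    have h2 : (j : ℝ) + 2 ≠ 0 := by positivity
    have : t₀ * ((j : ℝ) + 2) = t₀ * (i + 2) := by
      simpa [div_eq_div_iff h1 h2] using hij
    have := mul_left_cancel₀ ht₀.ne' this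
    exact_mod_cast (by linarith : (i : ℝ) = j)
  refine ⟨(Finset.range (d + 1)).image fun i : ℕ => t₀ / (i + 2 : ℝ),
    fun t => (Lagrange.basis ((Finset.range (d + 1)).image fun i : ℕ => t₀ / (i + 2 : ℝ))
      id t).eval 1, ?_, ?_⟩
  · intro t ht
    obtain ⟨i, -, rfl⟩ := Finset.mem_image.1 ht
    have : (0 : ℝ) < i + 2 := by positivity
    refine ⟨by positivity, ?_⟩
    rw [div_lt_iff₀ this]
    nlinarith [(Nat.cast_nonneg i : (0 : ℝ) ≤ i)]
  · intro P hP
    set s := (Finset.range (d + 1)).image fun i : ℕ => t₀ / (i + 2 : ℝ) with hs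
    have hcard : s.card = d + 1 := by
      rw [hs, Finset.card_image_of_injective _ hinj, Finset.card_range]
    have hdeg : P.degree < s.card := by
      rw [hcard]
      exact (Polynomial.degree_le_natDegree).trans_lt (by exact_mod_cast Nat.lt_succ_of_le hP)
    have h := Lagrange.eq_interpolate (s := s) (v := (id : ℝ → ℝ)) (injOn_id _) hdeg
    conv_lhs => rw [h, Lagrange.interpolate_apply]
    simp [eval_finsetSum, mul_comm]

variable {E : Type*} [NormedAddCommGroup E] [InnerProductSpace ℝ E] [FiniteDimensional ℝ E]

theorem exists_polynomial_eval_eq_det (M : E →L[ℝ] E) :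
    ∃ P : ℝ[X], P.natDegree ≤ Module.finrank ℝ E ∧
      ∀ t : ℝ, P.eval t = (1 + t • M : E →L[ℝ] E).det := by
  classical
  let b := Module.finBasis ℝ E
  let A := LinearMap.toMatrix b b (M : E →ₗ[ℝ] E)
  refine ⟨Matrix.det ((X : ℝ[X]) • A.map C + (1 : Matrix _ _ ℝ).map C),
    (natDegree_det_X_add_C_le A 1).trans (by simp), fun t => ?_⟩
  have h1 : (1 + t • M : E →L[ℝ] E).det
      = (LinearMap.toMatrix b b ((1 + t • M : E →L[ℝ] E) : E →ₗ[ℝ] E)).det := by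
    rw [LinearMap.det_toMatrix]
  have h2 : LinearMap.toMatrix b b ((1 + t • M : E →L[ℝ] E) : E →ₗ[ℝ] E) = 1 + t • A := by
    have : ((1 + t • M : E →L[ℝ] E) : E →ₗ[ℝ] E) = LinearMap.id + t • (M : E →ₗ[ℝ] E) := rfl
    rw [this, map_add, map_smul, LinearMap.toMatrix_id]
  rw [h1, h2, ← coe_evalRingHom, RingHom.map_det]
  congr 1
  ext i j
  simp only [RingHom.mapMatrix_apply, Matrix.map_apply, Matrix.add_apply, Matrix.smul_apply,
    smul_eq_mul, coe_evalRingHom, eval_add, eval_mul, eval_X, eval_C]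
  ring

variable [MeasurableSpace E] [BorelSpace E]

/-- A small multiple of a Lipschitz vector field that vanishes outside a ball deforms the identity
into a bijection that maps the ball onto itself, so that the change of variables formula computes
the volume of the ball. -/
theorem exists_setIntegral_det_eq_volume {φ : E → E} {L : ℝ≥0} {R : ℝ} (hφ : LipschitzWith L φ)
    (h0 : ∀ x, R ≤ ‖x‖ → φ x = 0) (hd : ∀ x ∈ ball (0 : E) R, DifferentiableAt ℝ φ x) :
    ∃ t₀ > 0, ∀ t ∈ Ioo (0 : ℝ) t₀,
      ∫ x in ball (0 : E) R, (1 + t • fderiv ℝ φ x : E →L[ℝ] E).det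
        = volume.real (ball (0 : E) R) := by
  obtain ⟨δ, hδ, hdet⟩ : ∃ δ > 0, ∀ A : E →L[ℝ] E, dist A 1 < δ → 0 < A.det := by
    have hc : Tendsto (fun A : E →L[ℝ] E => A.det) (𝓝 1) (𝓝 1) := by
      have := (ContinuousLinearMap.continuous_det (𝕜 := ℝ) (E := E)).tendsto 1
      have h1 : (1 : E →L[ℝ] E).det = 1 := by
        change LinearMap.det (LinearMap.id : E →ₗ[ℝ] E) = 1
        simp
      rwa [h1] at this
    exact Metric.eventually_nhds_iff.1 (hc.eventually (lt_mem_nhds one_pos))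
  refine ⟨min 1 δ / (L + 1), by positivity, fun t ht => ?_⟩
  have hL1 : (0 : ℝ) < L + 1 := by positivity
  have htL : t * L < min 1 δ := by
    have := (lt_div_iff₀ hL1).1 ht.2
    nlinarith [ht.1]
  have htL1 : t * L < 1 := htL.trans_le (min_le_left _ _)
  have htLδ : t * L < δ := htL.trans_le (min_le_right _ _)
  set f : E → E := fun x => x + t • φ x with hf
  have hinj : Function.Injective f := by
    intro x y hxy
    have h1 : x - y = t • (φ y - φ x) := by
      have : x + t • φ x = y + t • φ y := hxy
      rw [smul_sub, sub_eq_sub_iff_add_eq_add, this, add_comm]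
    have h2 : ‖x - y‖ ≤ t * (L * ‖x - y‖) := by
      conv_lhs => rw [h1, norm_smul, Real.norm_of_nonneg ht.1.le]
      have := hφ.norm_sub_le y x
      rw [norm_sub_rev y x] at this
      exact mul_le_mul_of_nonneg_left this ht.1.le
    have h3 : ‖x - y‖ = 0 := by
      by_contra hne
      have : 0 < ‖x - y‖ := lt_of_le_of_ne (norm_nonneg _) (Ne.symm hne)
      nlinarith
    exact sub_eq_zero.1 (norm_eq_zero.1 h3)
  have hsurj : Function.Surjective f := by
    intro y
    have hcontr : ContractingWith ⟨t * L, mul_nonneg ht.1.le L.2⟩ fun x => y - t • φ x := by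
      refine ⟨by exact_mod_cast htL1, LipschitzWith.of_dist_le_mul fun a b => ?_⟩
      rw [dist_eq_norm, dist_eq_norm, sub_sub_sub_cancel_left, ← smul_sub, norm_smul,
        Real.norm_of_nonneg ht.1.le, norm_sub_rev a b]
      change _ ≤ t * L * _
      rw [mul_assoc]
      exact mul_le_mul_of_nonneg_left (hφ.norm_sub_le b a) ht.1.le
    refine ⟨hcontr.fixedPoint, ?_⟩
    have h := hcontr.fixedPoint_isFixedPt
    have h' : y - t • φ hcontr.fixedPoint = hcontr.fixedPoint := h
    change hcontr.fixedPoint + t • φ hcontr.fixedPoint = y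
    conv_lhs => enter [1]; rw [← h']
    simp
  have hout : ∀ x, x ∉ ball (0 : E) R → f x = x := by
    intro x hx
    have : φ x = 0 := h0 x (by simpa using hx)
    simp [hf, this]
  have himg : f '' ball (0 : E) R = ball 0 R := by
    apply Subset.antisymm
    · rintro _ ⟨x, hx, rfl⟩
      by_contra hfx
      exact hfx (by rwa [hinj (hout _ hfx)])
    · intro y hy
      obtain ⟨x, rfl⟩ := hsurj y
      refine ⟨x, ?_, rfl⟩
      by_contra hx
      rw [hout x hx] at hy
      exact hx hy
  have hderiv : ∀ x ∈ ball (0 : E) R,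
      HasFDerivWithinAt f (1 + t • fderiv ℝ φ x : E →L[ℝ] E) (ball 0 R) x := fun x hx =>
    ((hasFDerivAt_id x).add ((hd x hx).hasFDerivAt.const_smul t)).hasFDerivWithinAt
  have hpos : ∀ x, 0 < (1 + t • fderiv ℝ φ x : E →L[ℝ] E).det := by
    intro x
    apply hdet
    rw [dist_eq_norm, add_sub_cancel_left, norm_smul, Real.norm_of_nonneg ht.1.le]
    exact (mul_le_mul_of_nonneg_left (norm_fderiv_le_of_lipschitz ℝ hφ) ht.1.le).trans_lt htLδ
  have h := integral_image_eq_integral_abs_det_fderiv_smul volume measurableSet_ball hderiv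
    hinj.injOn (fun _ => (1 : ℝ))
  rw [himg] at h
  simp only [smul_eq_mul, mul_one, abs_of_pos (hpos _)] at h
  rw [← h]
  simp

/-- There is no continuously differentiable retraction of a ball onto its boundary sphere. -/
theorem false_of_retraction {r : E → E} {R : ℝ} (hR : 0 < R)
    (hr : ∀ x ∈ closedBall (0 : E) R, ContDiffAt ℝ 1 r x)
    (hid : ∀ x ∈ sphere (0 : E) R, r x = x) (hnorm : ∀ x ∈ closedBall (0 : E) R, ‖r x‖ = R) :
    False := by
  classical
  set φ : E → E := fun x => if x ∈ ball (0 : E) R then r x - x else 0 with hφdef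
  have hφin : ∀ x ∈ closedBall (0 : E) R, φ x = r x - x := by
    intro x hx
    by_cases hxb : x ∈ ball (0 : E) R
    · simp only [hφdef, if_pos hxb]
    · have : x ∈ sphere (0 : E) R := by
        simp only [mem_closedBall, mem_ball, mem_sphere] at *
        exact le_antisymm hx (not_lt.1 hxb)
      simp only [hφdef, if_neg hxb, hid x this, sub_self]
  have hφout : ∀ x, R ≤ ‖x‖ → φ x = 0 := by
    intro x hx
    exact if_neg (by simpa using hx)
  obtain ⟨L, hL⟩ : ∃ L, LipschitzOnWith L φ (closedBall (0 : E) R) := by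
    have h1 : LocallyLipschitzOn (closedBall (0 : E) R) (fun x => r x - x) := by
      intro x hx
      obtain ⟨K, s, hs, hK⟩ := ((hr x hx).sub contDiffAt_id).exists_lipschitzOnWith
      exact ⟨K, s, mem_nhdsWithin_of_mem_nhds hs, hK⟩
    obtain ⟨L, hL⟩ := h1.exists_lipschitzOnWith_of_compact (isCompact_closedBall _ _)
    refine ⟨L, fun x hx y hy => ?_⟩
    rw [hφin x hx, hφin y hy]
    exact hL hx hy
  -- The field is extended by zero: a segment leaving the ball meets the sphere, where it vanishes.
  have hcross : ∀ x y : E, ‖x‖ ≤ R → R ≤ ‖y‖ → ‖φ x - φ y‖ ≤ L * ‖x - y‖ := by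
    intro x y hx hy
    obtain ⟨s, hs, hsR⟩ : ∃ s ∈ Icc (0 : ℝ) 1, ‖x + s • (y - x)‖ = R := by
      have hc : ContinuousOn (fun s : ℝ => ‖x + s • (y - x)‖) (Icc 0 1) := by fun_prop
      exact intermediate_value_Icc zero_le_one hc (by simpa using ⟨hx, hy⟩)
    have hz : φ (x + s • (y - x)) = 0 := hφout _ hsR.ge
    have h1 := hL.norm_sub_le (x := x) (by simpa using hx) (y := x + s • (y - x))
      (by simpa using hsR.le)
    rw [hz, sub_add_cancel_left, norm_neg, norm_smul, Real.norm_of_nonneg hs.1] at h1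
    rw [hφout y hy]
    refine h1.trans (mul_le_mul_of_nonneg_left ?_ L.2)
    rw [norm_sub_rev x y]
    exact mul_le_of_le_one_left (norm_nonneg _) hs.2
  have hLip : LipschitzWith L φ := by
    refine LipschitzWith.of_dist_le_mul fun x y => ?_
    rw [dist_eq_norm, dist_eq_norm]
    rcases le_total ‖x‖ R with hx | hx <;> rcases le_total ‖y‖ R with hy | hy
    · exact hL.norm_sub_le (by simpa using hx) (by simpa using hy)
    · exact hcross x y hx hy
    · rw [norm_sub_rev, norm_sub_rev x]
      exact hcross y x hy hx
    · rw [hφout x hx, hφout y hy]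
      simp; positivity
  have heq : ∀ x ∈ ball (0 : E) R, φ =ᶠ[𝓝 x] fun x => r x - x := fun x hx => by
    filter_upwards [isOpen_ball.mem_nhds hx] with y hy using hφin y (ball_subset_closedBall hy)
  have hrd : ∀ x ∈ ball (0 : E) R, DifferentiableAt ℝ r x := fun x hx =>
    (hr x (ball_subset_closedBall hx)).differentiableAt one_ne_zero
  have hφd : ∀ x ∈ ball (0 : E) R, DifferentiableAt ℝ φ x := fun x hx =>
    ((hrd x hx).sub differentiableAt_id).congr_of_eventuallyEq (heq x hx)
  have hfd : ∀ x ∈ ball (0 : E) R, fderiv ℝ φ x = fderiv ℝ r x - 1 := fun x hx => by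
    rw [(heq x hx).fderiv_eq]
    exact ((hrd x hx).hasFDerivAt.sub (hasFDerivAt_id x)).fderiv
  obtain ⟨t₀, ht₀, hvol⟩ := exists_setIntegral_det_eq_volume hLip hφout hφd
  obtain ⟨s, c, hs, hc⟩ := exists_eval_one_eq_sum (Module.finrank ℝ E) ht₀
  -- The derivative of `r` takes values orthogonal to `r`, hence is singular.
  have hdet1 : ∀ x ∈ ball (0 : E) R, (1 + (1 : ℝ) • fderiv ℝ φ x : E →L[ℝ] E).det = 0 := by
    intro x hx
    rw [one_smul, hfd x hx, add_sub_cancel]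
    by_contra hne
    have hsur : Function.Surjective (fderiv ℝ r x) := by
      have hu : IsUnit (LinearMap.det (fderiv ℝ r x : E →ₗ[ℝ] E)) := isUnit_iff_ne_zero.2 hne
      have := LinearMap.isUnit_iff_range_eq_top _ |>.1 ((LinearMap.isUnit_iff_isUnit_det _).2 hu)
      exact LinearMap.range_eq_top.1 this
    obtain ⟨v, hv⟩ := hsur (r x)
    have hconst : (fun y => inner ℝ (r y) (r y)) =ᶠ[𝓝 x] fun _ => R ^ 2 := by
      filter_upwards [isOpen_ball.mem_nhds hx] with y hy
      rw [real_inner_self_eq_norm_sq, hnorm y (ball_subset_closedBall hy)]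
    have hder := ((hrd x hx).hasFDerivAt.inner ℝ (hrd x hx).hasFDerivAt).fderiv
    rw [hconst.fderiv_eq] at hder
    have h2 := congrArg (fun A => A v) hder
    simp [hv, hnorm x (ball_subset_closedBall hx)] at h2
    nlinarith [pow_pos hR 2]
  choose P hPdeg hPeval using fun x => exists_polynomial_eval_eq_det (fderiv ℝ φ x)
  have hint : ∀ t : ℝ, IntegrableOn (fun x => (1 + t • fderiv ℝ φ x : E →L[ℝ] E).det)
      (ball (0 : E) R) := by
    intro t
    have hcont : ContinuousOn (fun x => (1 + t • (fderiv ℝ r x - 1) : E →L[ℝ] E).det)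
        (closedBall (0 : E) R) := by
      intro x hx
      have h1 : ContinuousAt (fderiv ℝ r) x := (hr x hx).continuousAt_fderiv one_ne_zero
      have h2 : ContinuousAt (fun x => (1 + t • (fderiv ℝ r x - 1) : E →L[ℝ] E)) x := by fun_prop
      exact (ContinuousLinearMap.continuous_det.continuousAt.comp h2).continuousWithinAt
    refine ((hcont.integrableOn_compact (isCompact_closedBall _ _)).mono_set
      ball_subset_closedBall).congr_fun (fun x hx => ?_) measurableSet_ball
    simp only [hfd x hx]
  have hzero : ∫ x in ball (0 : E) R, (1 + (1 : ℝ) • fderiv ℝ φ x : E →L[ℝ] E).det = 0 := by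
    rw [setIntegral_congr_fun measurableSet_ball hdet1]
    simp
  have hsum : ∫ x in ball (0 : E) R, (1 + (1 : ℝ) • fderiv ℝ φ x : E →L[ℝ] E).det
      = ∑ t ∈ s, c t * volume.real (ball (0 : E) R) := by
    have : ∀ x, (1 + (1 : ℝ) • fderiv ℝ φ x : E →L[ℝ] E).det
        = ∑ t ∈ s, c t * (1 + t • fderiv ℝ φ x : E →L[ℝ] E).det := by
      intro x
      simp only [← hPeval]
      exact hc _ (hPdeg x)
    simp only [this]
    rw [integral_finsetSum _ fun t _ => (hint t).const_mul (c t)]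
    refine Finset.sum_congr rfl fun t ht => ?_
    rw [integral_const_mul, hvol t (hs t ht)]
  have hone : ∑ t ∈ s, c t = 1 := by
    have := hc 1 (by simp)
    simpa using this.symm
  rw [← Finset.sum_mul, hone, one_mul, hzero] at hsum
  have hvpos : 0 < volume.real (ball (0 : E) R) :=
    ENNReal.toReal_pos (measure_ball_pos _ _ hR).ne' measure_ball_lt_top.ne
  exact hvpos.ne hsum

/-- A continuous vector field on a finite-dimensional space that points outwards on a sphere has a
zero in the ball.  For a smooth field `P` without zeros, following the ray from `x` in the direction
`P x` up to the sphere would be a retraction. -/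
theorem exists_zero_of_inner_pos {G : E → E} {R : ℝ} (hR : 0 < R) (hG : Continuous G)
    (hpos : ∀ x, ‖x‖ = R → 0 < inner ℝ (G x) x) : ∃ x, ‖x‖ ≤ R ∧ G x = 0 := by
  by_contra! hne
  obtain ⟨ε₁, hε₁, hε₁G⟩ : ∃ ε > 0, ∀ x ∈ closedBall (0 : E) R, ε ≤ ‖G x‖ := by
    obtain ⟨x, hx, hmin⟩ := (isCompact_closedBall (0 : E) R).exists_isMinOn
      ⟨0, by simpa using hR.le⟩ hG.norm.continuousOn
    exact ⟨‖G x‖, norm_pos_iff.2 (hne x (by simpa using hx)), fun y hy => hmin hy⟩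
  obtain ⟨ε₂, hε₂, hε₂G⟩ : ∃ ε > 0, ∀ x ∈ sphere (0 : E) R, ε ≤ inner ℝ (G x) x := by
    rcases (sphere (0 : E) R).eq_empty_or_nonempty with h | h
    · exact ⟨1, one_pos, by simp [h]⟩
    · obtain ⟨x, hx, hmin⟩ := (isCompact_sphere (0 : E) R).exists_isMinOn h
        (hG.inner (𝕜 := ℝ) continuous_id).continuousOn
      exact ⟨_, hpos x (by simpa using hx), fun y hy => hmin hy⟩
  obtain ⟨P, hP, hPG⟩ : ∃ P : E → E, ContDiff ℝ 1 P ∧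
      ∀ x, dist (P x) (G x) < min ε₁ (ε₂ / R) := by
    obtain ⟨P, hP, hPG, -⟩ := hG.exists_contDiff_approx 1
      (ε := fun _ => min ε₁ (ε₂ / R)) continuous_const (fun _ => by positivity)
    exact ⟨P, hP, hPG⟩
  have hP0 : ∀ x ∈ closedBall (0 : E) R, P x ≠ 0 := by
    intro x hx h
    have h1 := (hPG x).trans_le (min_le_left _ _)
    rw [h, dist_zero_left] at h1
    exact absurd (hε₁G x hx) (not_le.2 h1)
  have hPpos : ∀ x ∈ sphere (0 : E) R, 0 < inner ℝ x (P x) := by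
    intro x hx
    have hxR : ‖x‖ = R := by simpa using hx
    have h1 := (hPG x).trans_le (min_le_right _ _)
    rw [dist_eq_norm, lt_div_iff₀ hR] at h1
    have h2 := neg_le_of_abs_le (abs_real_inner_le_norm (P x - G x) x)
    rw [inner_sub_left, hxR] at h2
    have h3 := hε₂G x hx
    rw [real_inner_comm]
    linarith
  set a : E → ℝ := fun x => ‖P x‖ ^ 2
  set b : E → ℝ := fun x => inner ℝ x (P x)
  set D : E → ℝ := fun x => b x ^ 2 + a x * (R ^ 2 - ‖x‖ ^ 2)
  -- `s x` is the larger root of `s ↦ ‖x + s P x‖² - R²`.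
  set s : E → ℝ := fun x => (-b x + √(D x)) / a x
  have ha : ∀ x ∈ closedBall (0 : E) R, 0 < a x := fun x hx =>
    pow_pos (norm_pos_iff.2 (hP0 x hx)) 2
  have hD : ∀ x ∈ closedBall (0 : E) R, 0 < D x := by
    intro x hx
    have hxR : ‖x‖ ≤ R := by simpa using hx
    rcases hxR.lt_or_eq with h | h
    · have : 0 < R ^ 2 - ‖x‖ ^ 2 := by nlinarith [norm_nonneg x]
      exact add_pos_of_nonneg_of_pos (sq_nonneg _) (mul_pos (ha x hx) this)
    · have := hPpos x (by simpa using h)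
      simp only [D, h, sub_self, mul_zero, add_zero]
      exact pow_pos this 2
  refine false_of_retraction (r := fun x => x + s x • P x) hR ?_ ?_ ?_
  · intro x hx
    have hPx : ContDiffAt ℝ 1 P x := hP.contDiffAt
    have hax : ContDiffAt ℝ 1 a x := hPx.norm_sq ℝ
    have hbx : ContDiffAt ℝ 1 b x := contDiffAt_id.inner ℝ hPx
    have hDx : ContDiffAt ℝ 1 D x :=
      (hbx.pow 2).add (hax.mul (contDiffAt_const.sub (contDiffAt_id.norm_sq ℝ)))
    exact contDiffAt_id.add
      (((hbx.neg.add (hDx.sqrt (hD x hx).ne')).div hax (ha x hx).ne').smul hPx)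
  · intro x hx
    have hxR : ‖x‖ = R := by simpa using hx
    have : s x = 0 := by
      simp only [s, D, hxR, sub_self, mul_zero, add_zero]
      rw [Real.sqrt_sq (hPpos x hx).le]
      simp [b]
    simp [this]
  · intro x hx
    have h1 : s x * a x = -b x + √(D x) := div_mul_cancel₀ _ (ha x hx).ne'
    have h2 : √(D x) ^ 2 = D x := Real.sq_sqrt (hD x hx).le
    have h3 : ‖x + s x • P x‖ ^ 2 = ‖x‖ ^ 2 + 2 * (s x * b x) + s x ^ 2 * a x := by
      rw [norm_add_sq_real, inner_smul_right, norm_smul, mul_pow, Real.norm_eq_abs, sq_abs]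
    have h4 : a x * (‖x + s x • P x‖ ^ 2 - R ^ 2) = 0 := by
      have h5 : √(D x) = s x * a x + b x := by linarith
      rw [h5] at h2
      simp only [D] at h2
      rw [h3]
      linear_combination h2
    have h5 : ‖x + s x • P x‖ ^ 2 = R ^ 2 :=
      sub_eq_zero.1 ((mul_eq_zero.1 h4).resolve_left (ha x hx).ne')
    exact (pow_left_inj₀ (norm_nonneg _) hR.le two_ne_zero).1 h5

end Brouwer

/-! ### Weak compactness in reflexive spaces -/

section Reflexive

variable {E : Type*} [NormedAddCommGroup E] [NormedSpace ℝ E]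

theorem exists_dual_ne_zero_of_notMem {S : Submodule ℝ E} (hS : IsClosed (S : Set E)) {x : E}
    (hx : x ∉ S) : ∃ f : StrongDual ℝ E, (∀ y ∈ S, f y = 0) ∧ f x ≠ 0 := by
  have : IsClosed (S : Set E) := hS
  have hne : S.mkQ x ≠ 0 := by simpa [Submodule.Quotient.mk_eq_zero] using hx
  obtain ⟨g, hg⟩ := SeparatingDual.exists_ne_zero (R := ℝ) hne
  refine ⟨g.comp S.mkQL, fun y hy => ?_, hg⟩
  have : S.mkQ y = 0 := by simpa [Submodule.Quotient.mk_eq_zero] using hy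
  change g (S.mkQ y) = 0
  rw [this, map_zero]

theorem IsReflexiveSpace.submodule (hE : IsReflexiveSpace E) {S : Submodule ℝ E}
    (hS : IsClosed (S : Set E)) : IsReflexiveSpace S := by
  intro Φ
  let res : StrongDual ℝ E →L[ℝ] StrongDual ℝ S :=
    (ContinuousLinearMap.compL ℝ S E ℝ).flip S.subtypeL
  have hres : ∀ (f : StrongDual ℝ E) (y : S), res f y = f y := fun f y => rfl
  obtain ⟨x, hx⟩ := hE (Φ.comp res)
  have hx' : ∀ f : StrongDual ℝ E, f x = Φ (res f) := fun f => by
    rw [← NormedSpace.dual_def ℝ E x f, hx]; rfl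
  have hxS : x ∈ S := by
    by_contra hxS
    obtain ⟨f, hf, hfx⟩ := exists_dual_ne_zero_of_notMem hS hxS
    have : res f = 0 := by
      ext y
      exact hf y y.2
    exact hfx (by rw [hx', this, map_zero])
  refine ⟨⟨x, hxS⟩, ?_⟩
  ext g
  obtain ⟨f, hf, -⟩ := exists_extension_norm_eq S g
  have hfg : res f = g := by
    ext y
    exact hf y
  rw [NormedSpace.dual_def, ← hfg, ← hx' f]
  rfl

theorem exists_norm_le_two_mul_abs_apply (z : StrongDual ℝ E) :
    ∃ w : E, ‖w‖ ≤ 1 ∧ ‖z‖ ≤ 2 * |z w| := by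
  rcases eq_or_ne z 0 with rfl | hz
  · exact ⟨0, by simp, by simp⟩
  have hz' : 0 < ‖z‖ := norm_pos_iff.2 hz
  obtain ⟨w, hw, hzw⟩ := ContinuousLinearMap.exists_lt_apply_of_lt_opNorm z
    (half_lt_self hz')
  refine ⟨w, hw.le, ?_⟩
  rw [Real.norm_eq_abs] at hzw
  linarith

theorem separableSpace_of_separableSpace_dual
    [TopologicalSpace.SeparableSpace (StrongDual ℝ E)] : TopologicalSpace.SeparableSpace E := by
  choose w hw hzw using exists_norm_le_two_mul_abs_apply (E := E)
  let d := TopologicalSpace.denseSeq (StrongDual ℝ E)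
  set S := (Submodule.span ℝ (range fun n => w (d n))).topologicalClosure with hSdef
  have hsep : TopologicalSpace.IsSeparable (S : Set E) := by
    rw [hSdef, Submodule.topologicalClosure_coe]
    exact ((countable_range _).isSeparable.span (R := ℝ)).closure
  have hmem : ∀ n, w (d n) ∈ S := fun n =>
    Submodule.le_topologicalClosure _ (Submodule.subset_span ⟨n, rfl⟩)
  have htop : ∀ x, x ∈ S := by
    intro x
    by_contra hx
    obtain ⟨f, hf, hfx⟩ :=
      exists_dual_ne_zero_of_notMem (Submodule.isClosed_topologicalClosure _) hx
    have hfpos : 0 < ‖f‖ := norm_pos_iff.2 fun h => hfx (by simp [h])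
    obtain ⟨n, hn⟩ := (TopologicalSpace.denseRange_denseSeq (StrongDual ℝ E)).exists_dist_lt f
      (ε := ‖f‖ / 4) (by positivity)
    change dist f (d n) < _ at hn
    rw [dist_eq_norm, norm_sub_rev] at hn
    have h1 : |d n (w (d n))| ≤ ‖f‖ / 4 := by
      have h2 := (d n - f).le_opNorm (w (d n))
      rw [sub_apply, hf _ (hmem n), sub_zero, Real.norm_eq_abs] at h2
      nlinarith [hw (d n), norm_nonneg (d n - f), norm_nonneg (w (d n))]
    have h2 := hzw (d n)
    have h3 := norm_sub_norm_le f (d n)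
    rw [norm_sub_rev] at h3
    linarith
  have : (S : Set E) = univ := eq_univ_of_forall htop
  rw [this] at hsep
  exact TopologicalSpace.isSeparable_univ_iff.1 hsep

/-- Bounded sequences in separable reflexive spaces have weakly convergent subsequences: the dual is
separable, and the sequential Banach-Alaoglu theorem applies in the bidual. -/
theorem IsReflexiveSpace.exists_weakTendsto_subseq [TopologicalSpace.SeparableSpace E]
    (hE : IsReflexiveSpace E) {u : ℕ → E} {C : ℝ} (hu : ∀ n, ‖u n‖ ≤ C) :
    ∃ (x : E) (φ : ℕ → ℕ), StrictMono φ ∧ WeakTendsto (fun n => u (φ n)) x := by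
  have : TopologicalSpace.SeparableSpace (StrongDual ℝ (StrongDual ℝ E)) :=
    hE.denseRange.separableSpace (NormedSpace.inclusionInDoubleDual ℝ E).continuous
  have : TopologicalSpace.SeparableSpace (StrongDual ℝ E) :=
    separableSpace_of_separableSpace_dual
  have hcpt := WeakDual.isSeqCompact_closedBall ℝ (StrongDual ℝ E) 0 C
  obtain ⟨Φ, -, φ, hφ, hlim⟩ := hcpt
    (x := fun n => StrongDual.toWeakDual (NormedSpace.inclusionInDoubleDual ℝ E (u n)))
    (fun n => by
      have := (NormedSpace.double_dual_bound ℝ E (u n)).trans (hu n)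
      simpa using this)
  obtain ⟨x, hx⟩ := hE (WeakDual.toStrongDual Φ)
  refine ⟨x, φ, hφ, fun f => ?_⟩
  have h := ((WeakDual.eval_continuous f).tendsto Φ).comp hlim
  have hfx : f x = Φ f := by
    rw [← NormedSpace.dual_def ℝ E x f, hx]; rfl
  rw [hfx]
  exact h

end Reflexive

/-! ### Reduction to separable subspaces -/

section Hull

variable {E : Type*} [NormedAddCommGroup E] [NormedSpace ℝ E]

open TopologicalSpace

theorem IsDemicontinuous.mem_closure_span {B : E → StrongDual ℝ E} (hB : IsDemicontinuous B)
    {c : Set E} {x : E} (hx : x ∈ closure c) :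
    B x ∈ (Submodule.span ℝ (B '' c)).topologicalClosure := by
  by_contra hmem
  obtain ⟨f, hf, hfx⟩ :=
    exists_dual_ne_zero_of_notMem (Submodule.isClosed_topologicalClosure _) hmem
  obtain ⟨u, hu, hux⟩ := mem_closure_iff_seq_limit.1 hx
  have h := hB u x hux f
  have h0 : ∀ n, f (B (u n)) = 0 := fun n =>
    hf _ (Submodule.le_topologicalClosure _ (Submodule.subset_span ⟨u n, hu n, rfl⟩))
  simp only [h0] at h
  exact hfx (tendsto_nhds_unique h tendsto_const_nhds)

/-- The values of a demicontinuous operator on a separable subspace `S` are normed, up to a constant,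
by a larger separable subspace; the factor `3` leaves room for approximating by countably many
functionals. -/
theorem IsDemicontinuous.exists_norming_submodule {B : E → StrongDual ℝ E}
    (hB : IsDemicontinuous B) {S : Submodule ℝ E} (hS : IsSeparable (S : Set E)) :
    ∃ S' : Submodule ℝ E, S ≤ S' ∧ IsSeparable (S' : Set E) ∧
      ∀ z ∈ Submodule.span ℝ (B '' S), ∃ w ∈ S', ‖w‖ ≤ 1 ∧ ‖z‖ ≤ 3 * |z w| := by
  choose w hw hzw using exists_norm_le_two_mul_abs_apply (E := E)
  obtain ⟨c, -, hc, hSc⟩ := hS.exists_countable_dense_subset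
  have hZ : IsSeparable ((Submodule.span ℝ (B '' c)).topologicalClosure : Set (StrongDual ℝ E)) := by
    rw [Submodule.topologicalClosure_coe]
    exact ((hc.image B).isSeparable.span (R := ℝ)).closure
  obtain ⟨d, -, hd, hZd⟩ := hZ.exists_countable_dense_subset
  refine ⟨Submodule.span ℝ (S ∪ w '' d), ?_, (hS.union (hd.image w).isSeparable).span (R := ℝ), ?_⟩
  · exact fun x hx => Submodule.subset_span (Or.inl hx)
  intro z hz
  rcases eq_or_ne z 0 with rfl | hz0
  · exact ⟨0, zero_mem _, by simp, by simp⟩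
  have hzpos : 0 < ‖z‖ := norm_pos_iff.2 hz0
  have hzZ : z ∈ (Submodule.span ℝ (B '' c)).topologicalClosure := by
    refine (Submodule.span_le.2 ?_ : Submodule.span ℝ (B '' S) ≤ _) hz
    rintro _ ⟨x, hx, rfl⟩
    exact hB.mem_closure_span (hSc hx)
  obtain ⟨y, hy, hzy⟩ := Metric.mem_closure_iff.1 (hZd hzZ) (‖z‖ / 9) (by positivity)
  refine ⟨w y, Submodule.subset_span (Or.inr ⟨y, hy, rfl⟩), hw y, ?_⟩
  rw [dist_eq_norm, norm_sub_rev] at hzy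
  have h1 := (y - z).le_opNorm (w y)
  have h2 : ‖y - z‖ * ‖w y‖ ≤ ‖z‖ / 9 := by
    nlinarith [hw y, norm_nonneg (y - z), norm_nonneg (w y)]
  rw [sub_apply, Real.norm_eq_abs] at h1
  have h3 := abs_sub_abs_le_abs_sub (y (w y)) (z (w y))
  have h4 := norm_sub_norm_le z y
  rw [norm_sub_rev] at h4
  have h5 := hzw y
  linarith

/-- A demicontinuous operator maps a separable set into a separable set, so that there is a closed
separable subspace on which the values of the operator on that subspace are normed.  Solving
`B u = 0` in `E` is thereby reduced to a Galerkin equation in a separable subspace. -/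
theorem IsDemicontinuous.exists_separable_submodule {B : E → StrongDual ℝ E}
    (hB : IsDemicontinuous B) :
    ∃ S : Submodule ℝ E, IsClosed (S : Set E) ∧ IsSeparable (S : Set E) ∧
      ∀ u ∈ S, (∀ w ∈ S, B u w = 0) → B u = 0 := by
  choose! next hle hsep hnorm using
    fun (S : Submodule ℝ E) (hS : IsSeparable (S : Set E)) => hB.exists_norming_submodule hS
  let s : ℕ → Submodule ℝ E := fun n => next^[n] ⊥
  have hs_succ : ∀ n, s (n + 1) = next (s n) := fun n => Function.iterate_succ_apply' _ _ _
  have hs_sep : ∀ n, IsSeparable (s n : Set E) := by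
    intro n
    induction n with
    | zero => exact (countable_singleton (0 : E)).isSeparable
    | succ n ih => rw [hs_succ]; exact hsep _ ih
  have hmono : Monotone s := monotone_nat_of_le_succ fun n => by
    rw [hs_succ]; exact hle _ (hs_sep n)
  have hcoe : ((⨆ n, s n : Submodule ℝ E) : Set E) = ⋃ n, (s n : Set E) :=
    Submodule.coe_iSup_of_directed _ hmono.directed_le
  refine ⟨(⨆ n, s n).topologicalClosure, Submodule.isClosed_topologicalClosure _, ?_, ?_⟩
  · rw [Submodule.topologicalClosure_coe, hcoe]
    exact (IsSeparable.iUnion hs_sep).closure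
  intro u hu hu0
  have hBu := hB.mem_closure_span (c := ((⨆ n, s n : Submodule ℝ E) : Set E)) hu
  have hbound : ∀ ε > 0, ‖B u‖ ≤ 4 * ε := by
    intro ε hε
    obtain ⟨z, hz, hzu⟩ := Metric.mem_closure_iff.1 hBu ε hε
    rw [hcoe, image_iUnion, Submodule.span_iUnion] at hz
    have hdir : Directed (· ≤ ·) fun n => Submodule.span ℝ (B '' (s n : Set E)) :=
      Monotone.directed_le fun m n hmn => Submodule.span_mono (image_mono (hmono hmn))
    obtain ⟨n, hn⟩ := (Submodule.mem_iSup_of_directed _ hdir).1 hz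
    obtain ⟨w, hw, hw1, hzw⟩ := hnorm _ (hs_sep n) z hn
    rw [← hs_succ] at hw
    have hw0 : B u w = 0 :=
      hu0 w (Submodule.le_topologicalClosure _ (Submodule.mem_iSup_of_mem _ hw))
    rw [dist_eq_norm, norm_sub_rev] at hzu
    have h1 := (z - B u).le_opNorm w
    have h2 : ‖z - B u‖ * ‖w‖ ≤ ε := by
      nlinarith [norm_nonneg (z - B u), norm_nonneg w]
    rw [sub_apply, hw0, sub_zero, Real.norm_eq_abs] at h1
    have h4 := norm_sub_norm_le (B u) z
    rw [norm_sub_rev] at h4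
    linarith
  refine norm_le_zero_iff.1 (le_of_forall_pos_le_add fun ε hε => ?_)
  have := hbound (ε / 4) (by positivity)
  linarith

end Hull

/-! ### Galerkin approximation -/

section Galerkin

variable {E : Type*} [NormedAddCommGroup E] [NormedSpace ℝ E]

theorem IsDemicontinuous.exists_galerkin_solution {B : E → StrongDual ℝ E}
    (hB : IsDemicontinuous B) {R : ℝ} (hR : 0 < R) (hpos : ∀ v, R ≤ ‖v‖ → 0 < B v v)
    (F : Submodule ℝ E) [FiniteDimensional ℝ F] :
    ∃ u ∈ F, ‖u‖ ≤ R ∧ ∀ w ∈ F, B u w = 0 := by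
  let e : EuclideanSpace ℝ (Fin (Module.finrank ℝ F)) ≃L[ℝ] F := toEuclidean.symm
  let ι : EuclideanSpace ℝ (Fin (Module.finrank ℝ F)) →L[ℝ] E := F.subtypeL.comp (e : EuclideanSpace ℝ (Fin (Module.finrank ℝ F)) →L[ℝ] F)
  let G : EuclideanSpace ℝ (Fin (Module.finrank ℝ F)) →
      EuclideanSpace ℝ (Fin (Module.finrank ℝ F)) := fun y => (InnerProductSpace.toDual ℝ _).symm ((B (ι y)).comp ι)
  have hGapply : ∀ y z, inner ℝ (G y) z = B (ι y) (ι z) := fun y z => by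
    simp [G]
  have hGcont : Continuous G := by
    refine (LinearIsometryEquiv.continuous _).comp (continuous_clm_apply.2 fun z => ?_)
    refine continuous_iff_seqContinuous.2 fun y x hyx => ?_
    exact hB _ _ ((ι.continuous.tendsto x).comp hyx) (NormedSpace.inclusionInDoubleDual ℝ E (ι z))
  let K : ℝ := ‖(e.symm : F →L[ℝ] EuclideanSpace ℝ (Fin (Module.finrank ℝ F)))‖
  have hK : ∀ y, ‖y‖ ≤ K * ‖ι y‖ := fun y => by
    simpa [K, ι] using (e.symm : F →L[ℝ] EuclideanSpace ℝ (Fin (Module.finrank ℝ F))).le_opNorm (e y)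
  have hK0 : 0 ≤ K := by positivity
  -- In Euclidean coordinates, the sphere of radius `(K + 1) R` lies in the region `R ≤ ‖ι y‖`.
  obtain ⟨y, -, hy⟩ := exists_zero_of_inner_pos (G := G) (R := (K + 1) * R) (by positivity) hGcont
    (fun y hy => by
      rw [hGapply]
      refine hpos _ ?_
      by_contra! hlt
      nlinarith [hK y])
  have hsol : ∀ w ∈ F, B (ι y) w = 0 := by
    intro w hw
    have h := hGapply y (e.symm ⟨w, hw⟩)
    have h2 : ι (e.symm ⟨w, hw⟩) = w := by simp [ι]
    rw [hy, inner_zero_left, h2] at h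
    exact h.symm
  refine ⟨ι y, (e y).2, ?_, hsol⟩
  by_contra! hlt
  exact (hpos _ hlt.le).ne' (hsol _ (e y).2)

/-- Existence theorem for coercive operators of pseudo-monotone type on a reflexive space, which is
not assumed to be separable.  Pseudo-monotonicity enters only through `hpm`, for bounded sequences
along which the duality pairings converge to zero. -/
theorem IsDemicontinuous.exists_eq_zero (hE : IsReflexiveSpace E) {B : E → StrongDual ℝ E}
    (hB : IsDemicontinuous B) {R : ℝ} (hR : 0 < R) (hpos : ∀ v, R ≤ ‖v‖ → 0 < B v v)
    {C : ℝ} (hC : ∀ v, ‖v‖ ≤ R → ‖B v‖ ≤ C)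
    (hpm : ∀ (u : ℕ → E) (x w : E), (∀ n, ‖u n‖ ≤ R) → WeakTendsto u x →
      Tendsto (fun n => B (u n) (u n - x)) atTop (𝓝 0) →
      Tendsto (fun n => B (u n) (u n - w)) atTop (𝓝 0) → B x (x - w) ≤ 0) :
    ∃ u, B u = 0 := by
  obtain ⟨S, hScl, hSsep, hS⟩ := hB.exists_separable_submodule
  have : TopologicalSpace.SeparableSpace S := hSsep.separableSpace
  have hC0 : 0 ≤ C := (norm_nonneg _).trans (hC 0 (by simpa using hR.le))
  let d : ℕ → E := fun i => TopologicalSpace.denseSeq S i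
  let F : ℕ → Submodule ℝ E := fun n => Submodule.span ℝ (d '' Iio n)
  have : ∀ n, FiniteDimensional ℝ (F n) := fun n =>
    FiniteDimensional.span_of_finite ℝ ((finite_Iio n).image d)
  have hFS : ∀ n, F n ≤ S := fun n => Submodule.span_le.2 (by
    rintro _ ⟨i, -, rfl⟩
    exact (TopologicalSpace.denseSeq S i).2)
  choose u huF huR hu0 using fun n => hB.exists_galerkin_solution hR hpos (F n)
  obtain ⟨x, φ, hφ, hx⟩ := (hE.submodule hScl).exists_weakTendsto_subseq
    (u := fun n => ⟨u n, hFS n (huF n)⟩) (C := R) huR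
  have hweak : WeakTendsto (fun n => u (φ n)) (x : E) := fun f => hx (f.comp S.subtypeL)
  have hlim : ∀ w ∈ S, Tendsto (fun n => B (u (φ n)) w) atTop (𝓝 0) := by
    intro w hw
    rw [Metric.tendsto_atTop]
    intro ε hε
    obtain ⟨i, hi⟩ := (TopologicalSpace.denseRange_denseSeq S).exists_dist_lt ⟨w, hw⟩
      (ε := ε / (C + 1)) (by positivity)
    rw [Subtype.dist_eq, dist_eq_norm] at hi
    change ‖w - d i‖ < _ at hi
    refine ⟨i + 1, fun n hn => ?_⟩
    have hdi : B (u (φ n)) (d i) = 0 :=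
      hu0 _ _ (Submodule.subset_span ⟨i, by
        have := hφ.id_le n
        simp only [mem_Iio, id_eq] at *
        omega, rfl⟩)
    have h1 := (B (u (φ n))).le_opNorm (w - d i)
    rw [map_sub, hdi, sub_zero] at h1
    rw [dist_zero_right]
    have h2 := hC _ (huR (φ n))
    rw [lt_div_iff₀ (by positivity)] at hi
    nlinarith [norm_nonneg (w - d i)]
  have hself : ∀ w ∈ S, Tendsto (fun n => B (u (φ n)) (u (φ n) - w)) atTop (𝓝 0) := by
    intro w hw
    have h : (fun n => B (u (φ n)) (u (φ n) - w)) = fun n => -B (u (φ n)) w := by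
      funext n
      rw [map_sub, hu0 _ _ (huF _), zero_sub]
    rw [h]
    simpa using (hlim w hw).neg
  have hle : ∀ w ∈ S, B x w ≤ 0 := by
    intro w hw
    have := hpm _ _ (x - w) (fun n => huR (φ n)) hweak (hself x x.2)
      (hself _ (S.sub_mem x.2 hw))
    simpa using this
  refine ⟨x, hS x x.2 fun w hw => le_antisymm (hle w hw) ?_⟩
  have := hle (-w) (S.neg_mem hw)
  rw [map_neg] at this
  linarith

end Galerkin

/-! ### Pseudo-monotone operators and their averages -/

section PseudoMonotone

variable {E : Type*} [NormedAddCommGroup E] [NormedSpace ℝ E]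

theorem isPseudoMonotone_iff {A : E → StrongDual ℝ E} :
    IsPseudoMonotone A ↔ ∀ (u : ℕ → E) (x : E), WeakTendsto u x →
      (∀ ε > 0, ∀ᶠ k in atTop, A (u k) (u k - x) < ε) →
      ∀ w : E, ∀ ε > 0, ∀ᶠ k in atTop, A x (x - w) - ε < A (u k) (u k - w) := by
  have hsup : ∀ a : ℕ → ℝ, limsup (fun k => (a k : EReal)) atTop ≤ 0 ↔
      ∀ ε > 0, ∀ᶠ k in atTop, a k < ε := by
    intro a
    rw [limsup_le_iff]
    constructor
    · intro h ε hε
      filter_upwards [h (ε : EReal) (by exact_mod_cast hε)] with k hk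
      exact_mod_cast hk
    · intro h y hy
      obtain ⟨ε, hε, hεy⟩ := EReal.lt_iff_exists_real_btwn.1 hy
      filter_upwards [h ε (by exact_mod_cast hε)] with k hk
      exact lt_trans (by exact_mod_cast hk) hεy
  have hinf : ∀ (c : ℝ) (a : ℕ → ℝ), (c : EReal) ≤ liminf (fun k => (a k : EReal)) atTop ↔
      ∀ ε > 0, ∀ᶠ k in atTop, c - ε < a k := by
    intro c a
    rw [le_liminf_iff]
    constructor
    · intro h ε hε
      filter_upwards [h ((c - ε : ℝ) : EReal) (by exact_mod_cast sub_lt_self c hε)] with k hk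
      exact_mod_cast hk
    · intro h y hy
      obtain ⟨d, hd, hdc⟩ := EReal.lt_iff_exists_real_btwn.1 hy
      have hdc' : d < c := by exact_mod_cast hdc
      filter_upwards [h (c - d) (sub_pos.2 hdc')] with k hk
      refine hd.trans ?_
      rw [sub_sub_cancel] at hk
      exact_mod_cast hk
  simp only [IsPseudoMonotone, hsup, hinf]

theorem WeakTendsto.comp {u : ℕ → E} {x : E} (h : WeakTendsto u x) {φ : ℕ → ℕ}
    (hφ : StrictMono φ) : WeakTendsto (fun n => u (φ n)) x :=
  fun f => (h f).comp hφ.tendsto_atTop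

theorem IsPseudoMonotone.eventually_neg_lt {A : E → StrongDual ℝ E} (hA : IsPseudoMonotone A)
    {u : ℕ → E} {x : E} (hu : WeakTendsto u x) {ε : ℝ} (hε : 0 < ε) :
    ∀ᶠ n in atTop, -ε < A (u n) (u n - x) := by
  by_contra hcon
  obtain ⟨φ, hφ, hle⟩ := extraction_of_frequently_atTop (not_eventually.1 hcon)
  have h := isPseudoMonotone_iff.1 hA _ x (hu.comp hφ)
    (fun δ hδ => Eventually.of_forall fun n => by linarith [not_lt.1 (hle n)]) x ε hε
  obtain ⟨n, hn⟩ := h.exists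
  rw [sub_self, map_zero, zero_sub] at hn
  exact hle n hn

variable {Y : Type*} [NormedAddCommGroup Y] [InnerProductSpace ℝ Y]

/-- The affine map `z ↦ κ j* j z - b`, where `j*` is the adjoint of `j : E → Y`. -/
noncomputable def affineTerm (κ : ℝ) (j : E →L[ℝ] Y) (b : StrongDual ℝ E) (z : E) :
    StrongDual ℝ E :=
  κ • (innerSL ℝ (j z)).comp j - b

theorem affineTerm_apply (κ : ℝ) (j : E →L[ℝ] Y) (b : StrongDual ℝ E) (z w : E) :
    affineTerm κ j b z w = κ * inner ℝ (j z) (j w) - b w := rfl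

theorem continuous_affineTerm (κ : ℝ) (j : E →L[ℝ] Y) (b : StrongDual ℝ E) :
    Continuous (affineTerm κ j b) := by
  unfold affineTerm
  have h1 : Continuous fun z => innerSL ℝ (j z) := (innerSL ℝ).continuous.comp j.continuous
  exact ((h1.clm_comp continuous_const).const_smul κ).sub continuous_const

theorem IsDemicontinuous.add_affineTerm {A : E → StrongDual ℝ E} (hA : IsDemicontinuous A)
    (κ : ℝ) (j : E →L[ℝ] Y) (b : StrongDual ℝ E) :
    IsDemicontinuous fun z => A z + affineTerm κ j b z := by
  intro u x hu f
  simp only [map_add]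
  exact (hA u x hu f).add
    ((f.continuous.comp (continuous_affineTerm κ j b)).tendsto x |>.comp hu)

theorem IsPseudoMonotone.add_affineTerm {A : E → StrongDual ℝ E} (hA : IsPseudoMonotone A)
    {κ : ℝ} (hκ : 0 ≤ κ) (j : E →L[ℝ] Y) (b : StrongDual ℝ E) :
    IsPseudoMonotone fun z => A z + affineTerm κ j b z := by
  rw [isPseudoMonotone_iff] at hA ⊢
  intro u x hu hlim w
  -- The affine part is bounded below by an expression linear in `u n`, since `0 ≤ ‖j (u n - x)‖²`.
  have key : ∀ y : E, ∀ ε > 0, ∀ᶠ n in atTop,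
      affineTerm κ j b x (x - y) - ε < affineTerm κ j b (u n) (u n - y) := by
    intro y ε hε
    have h1 := hu (κ • (innerSL ℝ (j x + j (x - y))).comp j - b)
    filter_upwards [h1.eventually (lt_mem_nhds (sub_lt_self _ hε))] with n hn
    simp only [sub_apply, smul_apply, ContinuousLinearMap.comp_apply, innerSL_apply_apply,
      smul_eq_mul, map_sub, inner_add_left, inner_sub_left] at hn
    simp only [affineTerm_apply, map_sub]
    have h2 : 0 ≤ κ * inner ℝ (j (u n) - j x) (j (u n) - j x) :=
      mul_nonneg hκ real_inner_self_nonneg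
    simp only [inner_sub_left, inner_sub_right] at h2
    rw [real_inner_comm (j x) (j (u n))] at h2
    have h3 := real_inner_comm (j (u n)) (j y)
    have h4 := real_inner_comm (j x) (j y)
    rw [h3, h4] at hn
    linarith
  have h := hA u x hu (fun ε hε => by
    filter_upwards [hlim (ε / 2) (half_pos hε), key x (ε / 2) (half_pos hε)] with n hn1 hn2
    rw [sub_self, map_zero, zero_sub] at hn2
    rw [add_apply] at hn1
    linarith) w
  intro ε hε
  filter_upwards [h (ε / 2) (half_pos hε), key w (ε / 2) (half_pos hε)] with n hn1 hn2
  rw [add_apply, add_apply]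
  linarith

end PseudoMonotone

section Average

variable {E Ω : Type*} [NormedAddCommGroup E] [NormedSpace ℝ E] [MeasurableSpace Ω]
  {ν : Measure Ω}

theorem integrable_of_ae_bound [IsFiniteMeasure ν] {A : Ω → E → StrongDual ℝ E}
    (hmeas : ∀ x, AEStronglyMeasurable (fun s => A s x) ν)
    (hbdd : ∀ r : ℝ, ∃ C : ℝ, ∀ᵐ s ∂ν, ∀ x, ‖x‖ ≤ r → ‖A s x‖ ≤ C) (x : E) :
    Integrable (fun s => A s x) ν := by
  obtain ⟨C, hC⟩ := hbdd ‖x‖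
  exact Integrable.of_bound (hmeas x) C (hC.mono fun s hs => hs x le_rfl)

theorem isDemicontinuous_integral [IsFiniteMeasure ν] {A : Ω → E → StrongDual ℝ E}
    (hdem : ∀ᵐ s ∂ν, IsDemicontinuous (A s))
    (hmeas : ∀ x, AEStronglyMeasurable (fun s => A s x) ν)
    (hbdd : ∀ r : ℝ, ∃ C : ℝ, ∀ᵐ s ∂ν, ∀ x, ‖x‖ ≤ r → ‖A s x‖ ≤ C) :
    IsDemicontinuous fun x => ∫ s, A s x ∂ν := by
  intro u x hu f
  obtain ⟨r, hr⟩ : ∃ r, ∀ n, ‖u n‖ ≤ r := by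
    obtain ⟨r, hr⟩ := (Metric.isBounded_range_of_tendsto u hu).exists_norm_le
    exact ⟨r, fun n => hr _ ⟨n, rfl⟩⟩
  obtain ⟨C, hC⟩ := hbdd r
  have hint := integrable_of_ae_bound hmeas hbdd
  simp only [← ContinuousLinearMap.integral_comp_comm f (hint _)]
  refine tendsto_integral_of_dominated_convergence (fun _ => ‖f‖ * C)
    (fun n => f.continuous.comp_aestronglyMeasurable (hmeas _)) (integrable_const _) ?_ ?_
  · intro n
    filter_upwards [hC] with s hs
    exact (f.le_opNorm _).trans (mul_le_mul_of_nonneg_left (hs _ (hr n)) (norm_nonneg _))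
  · filter_upwards [hdem] with s hs using hs u x hu f

/-- A sequence of uniformly bounded functions whose lower limits are nonnegative and whose integrals
tend to zero has a subsequence that tends to zero almost everywhere. -/
theorem exists_seq_tendsto_ae_zero [IsFiniteMeasure ν] {g : ℕ → Ω → ℝ} {M : ℝ}
    (hmeas : ∀ n, AEStronglyMeasurable (g n) ν) (hM : ∀ n, ∀ᵐ s ∂ν, ‖g n s‖ ≤ M)
    (hlow : ∀ᵐ s ∂ν, ∀ ε > 0, ∀ᶠ n in atTop, -ε < g n s)
    (hint : Tendsto (fun n => ∫ s, g n s ∂ν) atTop (𝓝 0)) :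
    ∃ φ : ℕ → ℕ, StrictMono φ ∧ ∀ᵐ s ∂ν, Tendsto (fun n => g (φ n) s) atTop (𝓝 0) := by
  have hgint : ∀ n, Integrable (g n) ν := fun n => Integrable.of_bound (hmeas n) M (hM n)
  have hgmin : ∀ n, Integrable (fun s => min (g n s) 0) ν := fun n =>
    (hgint n).inf (integrable_zero _ _ _)
  have hneg : Tendsto (fun n => ∫ s, min (g n s) 0 ∂ν) atTop (𝓝 (∫ _, (0 : ℝ) ∂ν)) := by
    refine tendsto_integral_of_dominated_convergence (fun _ => M)
      (fun n => (hgmin n).aestronglyMeasurable)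
      (integrable_const _) ?_ ?_
    · intro n
      filter_upwards [hM n] with s hs
      rw [Real.norm_eq_abs] at hs ⊢
      rw [abs_of_nonpos (min_le_right _ _)]
      rcases min_choice (g n s) 0 with h | h <;> rw [h]
      · exact (neg_le_abs _).trans hs
      · simpa using (abs_nonneg _).trans hs
    · filter_upwards [hlow] with s hs
      rw [Metric.tendsto_atTop']
      intro ε hε
      obtain ⟨N, hN⟩ := eventually_atTop.1 (hs ε hε)
      refine ⟨N, fun n hn => ?_⟩
      rw [dist_zero_right, Real.norm_eq_abs, abs_of_nonpos (min_le_right _ _)]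
      have := lt_min (hN n hn.le) (neg_lt_zero.2 hε)
      linarith
  rw [integral_zero] at hneg
  have habs : Tendsto (fun n => ∫ s, ‖g n s‖ ∂ν) atTop (𝓝 0) := by
    have h : ∀ n, ∫ s, ‖g n s‖ ∂ν = ∫ s, g n s ∂ν - 2 * ∫ s, min (g n s) 0 ∂ν := by
      intro n
      rw [← integral_const_mul, ← integral_sub (hgint n) ((hgmin n).const_mul 2)]
      congr 1 with s
      rw [Real.norm_eq_abs]
      rcases le_total (g n s) 0 with h | h
      · rw [abs_of_nonpos h, min_eq_left h]; ring
      · rw [abs_of_nonneg h, min_eq_right h]; ring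
    simp only [h]
    simpa using hint.sub (hneg.const_mul 2)
  have hL1 : TendstoInMeasure ν g atTop (fun _ => 0) := by
    refine tendstoInMeasure_of_tendsto_eLpNorm one_ne_zero hmeas aestronglyMeasurable_zero ?_
    have h : ∀ n, eLpNorm (g n - fun _ => 0) 1 ν = ENNReal.ofReal (∫ s, ‖g n s‖ ∂ν) := by
      intro n
      rw [ofReal_integral_norm_eq_lintegral_enorm (hgint n), eLpNorm_one_eq_lintegral_enorm]
      simp
    simp only [h]
    simpa using ENNReal.tendsto_ofReal habs
  exact hL1.exists_seq_tendsto_ae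

/-- Averages inherit pseudo-monotonicity along bounded sequences.  Pointwise pseudo-monotonicity
forces the lower limit of `⟨A s uₙ, uₙ - x⟩` to be nonnegative, so that convergence of the integrals
implies convergence almost everywhere along a subsequence. -/
theorem integral_apply_sub_le_of_isPseudoMonotone [IsFiniteMeasure ν] {A : Ω → E → StrongDual ℝ E}
    (hpm : ∀ᵐ s ∂ν, IsPseudoMonotone (A s))
    (hmeas : ∀ x, AEStronglyMeasurable (fun s => A s x) ν)
    (hbdd : ∀ r : ℝ, ∃ C : ℝ, ∀ᵐ s ∂ν, ∀ x, ‖x‖ ≤ r → ‖A s x‖ ≤ C)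
    {u : ℕ → E} {x w : E} {r a : ℝ} (hr : ∀ n, ‖u n‖ ≤ r) (hu : WeakTendsto u x)
    (hx : Tendsto (fun n => (∫ s, A s (u n) ∂ν) (u n - x)) atTop (𝓝 0))
    (hw : Tendsto (fun n => (∫ s, A s (u n) ∂ν) (u n - w)) atTop (𝓝 a)) :
    (∫ s, A s x ∂ν) (x - w) ≤ a := by
  have hint := integrable_of_ae_bound hmeas hbdd
  have happly : ∀ y z, (∫ s, A s y ∂ν) z = ∫ s, A s y z ∂ν := fun y z =>
    ContinuousLinearMap.integral_apply (hint y) z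
  simp only [happly] at hx hw ⊢
  have hmeas' : ∀ y z, AEStronglyMeasurable (fun s => A s y z) ν := fun y z =>
    (hmeas y).apply_continuousLinearMap z
  have hint' : ∀ y z, Integrable (fun s => A s y z) ν := fun y z =>
    (hint y).apply_continuousLinearMap z
  obtain ⟨C, hC⟩ := hbdd r
  have hbound : ∀ y : E, ∀ n, ∀ᵐ s ∂ν, ‖A s (u n) (u n - y)‖ ≤ C * (r + ‖y‖) := by
    intro y n
    filter_upwards [hC] with s hs
    have h1 := hs _ (hr n)
    exact ((A s (u n)).le_opNorm _).trans (mul_le_mul h1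
      ((norm_sub_le _ _).trans (by gcongr; exact hr n)) (norm_nonneg _) ((norm_nonneg _).trans h1))
  obtain ⟨φ, hφ, hae⟩ := exists_seq_tendsto_ae_zero (fun n => hmeas' (u n) (u n - x)) (hbound x)
    (hpm.mono fun s hs ε hε => hs.eventually_neg_lt hu hε) hx
  have hmin : Tendsto (fun n => ∫ s, min (A s (u (φ n)) (u (φ n) - w)) (A s x (x - w)) ∂ν) atTop
      (𝓝 (∫ s, A s x (x - w) ∂ν)) := by
    refine tendsto_integral_of_dominated_convergence
      (fun s => C * (r + ‖w‖) + ‖A s x (x - w)‖)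
      (fun n => ((hint' _ _).inf (hint' _ _)).aestronglyMeasurable)
      ((integrable_const _).add (hint' _ _).norm) ?_ ?_
    · intro n
      filter_upwards [hbound w (φ n)] with s hs
      rcases min_choice (A s (u (φ n)) (u (φ n) - w)) (A s x (x - w)) with h | h <;> rw [h]
      · exact hs.trans (le_add_of_nonneg_right (norm_nonneg _))
      · exact le_add_of_nonneg_left ((norm_nonneg _).trans hs)
    · filter_upwards [hpm, hae] with s hs hlim
      have h := isPseudoMonotone_iff.1 hs _ x (hu.comp hφ)
        (fun ε hε => hlim.eventually (gt_mem_nhds hε)) w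
      rw [Metric.tendsto_atTop']
      intro ε hε
      obtain ⟨N, hN⟩ := eventually_atTop.1 (h ε hε)
      refine ⟨N, fun n hn => ?_⟩
      rw [Real.dist_eq, abs_of_nonpos (sub_nonpos.2 (min_le_right _ _))]
      have := lt_min (hN n hn.le) (sub_lt_self (A s x (x - w)) hε)
      linarith
  refine le_of_tendsto_of_tendsto' hmin (hw.comp hφ.tendsto_atTop) fun n => ?_
  exact integral_mono ((hint' _ _).inf (hint' _ _)) (hint' _ _) fun s => min_le_left _ _

theorem exists_integral_eq_zero [IsProbabilityMeasure ν] (hE : IsReflexiveSpace E)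
    {A : Ω → E → StrongDual ℝ E}
    (hdem : ∀ᵐ s ∂ν, IsDemicontinuous (A s)) (hpm : ∀ᵐ s ∂ν, IsPseudoMonotone (A s))
    (hmeas : ∀ x, AEStronglyMeasurable (fun s => A s x) ν)
    (hbdd : ∀ r : ℝ, ∃ C : ℝ, ∀ᵐ s ∂ν, ∀ x, ‖x‖ ≤ r → ‖A s x‖ ≤ C)
    {R : ℝ} (hR : 0 < R) (hpos : ∀ v, R ≤ ‖v‖ → ∀ᵐ s ∂ν, 1 ≤ A s v v) :
    ∃ u, ∫ s, A s u ∂ν = 0 := by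
  have hint := integrable_of_ae_bound hmeas hbdd
  obtain ⟨C, hC⟩ := hbdd R
  refine (isDemicontinuous_integral hdem hmeas hbdd).exists_eq_zero hE hR (fun v hv => ?_)
    (C := C) (fun v hv => ?_) fun u x w hu hux hx hw =>
      integral_apply_sub_le_of_isPseudoMonotone hpm hmeas hbdd hu hux hx hw
  · rw [ContinuousLinearMap.integral_apply (hint v)]
    have h := integral_mono_ae (integrable_const (1 : ℝ))
      ((hint v).apply_continuousLinearMap v) (hpos v hv)
    rw [integral_const, probReal_univ, one_smul] at h
    exact one_pos.trans_le h
  · have h := norm_integral_le_of_norm_le_const (hC.mono fun s hs => hs v hv)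
    rwa [probReal_univ, mul_one] at h

end Average

/-! ### One step of the scheme -/

section Step

variable {X Y : Type*} [NormedAddCommGroup X] [NormedSpace ℝ X]
  [NormedAddCommGroup Y] [InnerProductSpace ℝ Y]

theorem restrictOperator_apply (S : Submodule ℝ X) (A : X → StrongDual ℝ X) (x w : S) :
    restrictOperator S A x w = A x w := rfl

theorem IsDemicontinuous.restrictOperator {A : X → StrongDual ℝ X} (hA : IsDemicontinuous A)
    (S : Submodule ℝ X) : IsDemicontinuous (restrictOperator S A) := fun u x hu f =>
  hA (fun n => (u n : X)) x ((S.subtypeL.continuous.tendsto x).comp hu)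
    (f.comp ((ContinuousLinearMap.compL ℝ S X ℝ).flip S.subtypeL))

theorem norm_restrictOperator_le (S : Submodule ℝ X) (A : X → StrongDual ℝ X) (x : S) :
    ‖restrictOperator S A x‖ ≤ ‖A x‖ :=
  ContinuousLinearMap.opNorm_le_bound _ (norm_nonneg _) fun w => (A x).le_opNorm w

theorem norm_affineTerm_le {κ : ℝ} (hκ : 0 ≤ κ) (j : X →L[ℝ] Y) (b : StrongDual ℝ X) (z : X) :
    ‖affineTerm κ j b z‖ ≤ κ * (‖j‖ * ‖z‖ * ‖j‖) + ‖b‖ := by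
  refine (norm_sub_le _ _).trans ?_
  gcongr
  rw [norm_smul, Real.norm_of_nonneg hκ]
  gcongr
  refine (ContinuousLinearMap.opNorm_comp_le _ _).trans ?_
  rw [innerSL_apply_norm]
  gcongr
  exact j.le_opNorm z

/-- The growth condition bounds an operator on bounded sets. -/
theorem norm_le_of_growth {p q lam γ r : ℝ} (hp : 0 ≤ p) (hq : 0 ≤ q) (hlam : 0 ≤ lam)
    (hγ : 0 ≤ γ) (hr : 0 ≤ r) {j : X →L[ℝ] Y} {A : X → StrongDual ℝ X}
    (hA : ∀ x y, |A x y| ≤ lam * ‖x‖ ^ p + γ * (1 + ‖j x‖ ^ q + ‖j y‖ ^ q + ‖y‖ ^ p))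
    {x : X} (hx : ‖x‖ ≤ r) :
    ‖A x‖ ≤ lam * r ^ p + γ * (1 + (‖j‖ * r) ^ q + ‖j‖ ^ q + 1) := by
  refine ContinuousLinearMap.opNorm_le_of_unit_norm (by positivity) fun y hy => ?_
  refine (hA x y).trans ?_
  have h1 : ‖j x‖ ≤ ‖j‖ * r := (j.le_opNorm x).trans (by gcongr)
  have h2 : ‖j y‖ ≤ ‖j‖ := by simpa [hy] using j.le_opNorm y
  rw [hy, Real.one_rpow]
  gcongr

theorem exists_radius_of_one_lt {p c₀ : ℝ} (hp : 1 < p) (hc₀ : 0 < c₀) (c₂ β : ℝ) :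
    ∃ R > 0, ∀ x, R ≤ x → 1 ≤ c₀ * x ^ p - c₂ - β * x := by
  have h := (tendsto_rpow_atTop (sub_pos.2 hp)).const_mul_atTop hc₀
  obtain ⟨R, hR⟩ := eventually_atTop.1 (h.eventually_ge_atTop (|c₂| + 1 + β))
  refine ⟨max R 1, by positivity, fun x hx => ?_⟩
  have hx1 : 1 ≤ x := (le_max_right _ _).trans hx
  have h1 := hR x ((le_max_left _ _).trans hx)
  have h2 : x ^ p = x ^ (p - 1) * x := by
    rw [← Real.rpow_add_one (by positivity), sub_add_cancel]
  rw [h2]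
  have h3 : (|c₂| + 1) * 1 ≤ (|c₂| + 1) * x := by gcongr
  have h4 : (|c₂| + 1 + β) * x ≤ c₀ * x ^ (p - 1) * x := by gcongr
  have h5 := le_abs_self c₂
  linarith

variable {Ω : Type*} [MeasurableSpace Ω] {ν : Measure Ω}

theorem exists_bound_of_growth {p q lam γ : ℝ} (hp : 0 ≤ p) (hq : 0 ≤ q) (hlam : 0 ≤ lam)
    (hγ : 0 ≤ γ) {j : X →L[ℝ] Y} {A : Ω → X → StrongDual ℝ X}
    (hA : ∀ᵐ s ∂ν, ∀ x y,
      |A s x y| ≤ lam * ‖x‖ ^ p + γ * (1 + ‖j x‖ ^ q + ‖j y‖ ^ q + ‖y‖ ^ p)) (r : ℝ) :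
    ∃ C : ℝ, ∀ᵐ s ∂ν, ∀ x, ‖x‖ ≤ r → ‖A s x‖ ≤ C :=
  ⟨_, hA.mono fun _ hs _ hx =>
    norm_le_of_growth hp hq hlam hγ (le_max_right r 0) hs (hx.trans (le_max_left _ _))⟩

/-- Solvability of a single step: the term `κ j* j` compensates the lower order term `c₁ ‖j v‖²` in
the coercivity estimate as soon as `c₁ ≤ κ`. -/
theorem exists_step_solution [IsProbabilityMeasure ν] (hX : IsReflexiveSpace X)
    {S : Submodule ℝ X} (hS : IsClosed (S : Set X)) (j : X →L[ℝ] Y) {A : Ω → X → StrongDual ℝ X}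
    {p c₀ c₁ c₂ κ : ℝ} (hp : 1 < p) (hc₀ : 0 < c₀) (hκ : 0 ≤ κ) (hc₁ : c₁ ≤ κ)
    (hdem : ∀ᵐ s ∂ν, IsDemicontinuous (A s))
    (hpm : ∀ᵐ s ∂ν, IsPseudoMonotone (restrictOperator S (A s)))
    (hmeas : ∀ x, AEStronglyMeasurable (fun s => A s x) ν)
    (hbdd : ∀ r : ℝ, ∃ C : ℝ, ∀ᵐ s ∂ν, ∀ x, ‖x‖ ≤ r → ‖A s x‖ ≤ C)
    (hcoer : ∀ᵐ s ∂ν, ∀ v ∈ S, c₀ * ‖v‖ ^ p - c₁ * ‖j v‖ ^ 2 - c₂ ≤ A s v v)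
    (b : StrongDual ℝ X) :
    ∃ u : S, ∀ w ∈ S, κ * inner ℝ (j u) (j w) + (∫ s, A s u ∂ν) w = b w := by
  set jS : S →L[ℝ] Y := j.comp S.subtypeL
  set bS : StrongDual ℝ S := b.comp S.subtypeL
  obtain ⟨R, hR, hRpos⟩ := exists_radius_of_one_lt hp hc₀ c₂ ‖bS‖
  have hres : ∀ x : S, AEStronglyMeasurable (fun s => restrictOperator S (A s) x) ν := fun x =>
    ((ContinuousLinearMap.compL ℝ S X ℝ).flip S.subtypeL).continuous.comp_aestronglyMeasurable
      (hmeas x)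
  have hbddS : ∀ r : ℝ, ∃ C : ℝ, ∀ᵐ s ∂ν, ∀ x : S, ‖x‖ ≤ r →
      ‖restrictOperator S (A s) x‖ ≤ C := fun r =>
    (hbdd r).imp fun C hC => hC.mono fun s hs x hx =>
      (norm_restrictOperator_le S (A s) x).trans (hs x hx)
  obtain ⟨u, hu⟩ := exists_integral_eq_zero (ν := ν) (hX.submodule hS)
    (A := fun s z => restrictOperator S (A s) z + affineTerm κ jS bS z)
    (hdem.mono fun s hs => (hs.restrictOperator S).add_affineTerm κ jS bS)
    (hpm.mono fun s hs => hs.add_affineTerm hκ jS bS)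
    (fun x => (hres x).add aestronglyMeasurable_const)
    (fun r => by
      obtain ⟨C, hC⟩ := hbddS r
      refine ⟨C + (κ * (‖jS‖ * r * ‖jS‖) + ‖bS‖), hC.mono fun s hs x hx => ?_⟩
      exact (norm_add_le _ _).trans
        (add_le_add (hs x hx) ((norm_affineTerm_le hκ jS bS x).trans (by gcongr))))
    hR (fun v hv => by
      filter_upwards [hcoer] with s hs
      have h1 := hs v v.2
      have h2 : bS v ≤ ‖bS‖ * ‖v‖ := (le_abs_self _).trans (bS.le_opNorm v)
      have h3 := hRpos ‖v‖ hv
      have h4 : c₁ * ‖j v‖ ^ 2 ≤ κ * ‖j v‖ ^ 2 := by gcongr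
      rw [add_apply, restrictOperator_apply, affineTerm_apply, real_inner_self_eq_norm_sq]
      change 1 ≤ A s v v + (κ * ‖j v‖ ^ 2 - bS v)
      rw [Submodule.coe_norm] at h2 h3
      linarith)
  refine ⟨u, fun w hw => ?_⟩
  have hint := integrable_of_ae_bound hmeas hbdd u
  have hintS := integrable_of_ae_bound hres hbddS u
  rw [integral_add hintS (integrable_const _), integral_const, probReal_univ, one_smul] at hu
  have h := congrArg (fun B => B ⟨w, hw⟩) hu
  simp only [add_apply, affineTerm_apply, zero_apply] at h
  rw [ContinuousLinearMap.integral_apply hintS] at h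
  rw [ContinuousLinearMap.integral_apply hint]
  change ∫ s, A s u w ∂ν + (κ * inner ℝ (j u) (j w) - b w) = 0 at h
  linarith

end Step

/-! ### The time grid and the iteration -/

theorem restrict_timeInterval_le {T : ℝ} (hT : 0 < T) {K k : ℕ} (hk : 1 ≤ k) (hkK : k ≤ K) :
    volume.restrict (timeInterval (T / K) k) ≤ timeMeasure T := by
  have hK : (0 : ℝ) < K := by exact_mod_cast (hk.trans hkK)
  have hk' : (1 : ℝ) ≤ k := by exact_mod_cast hk
  have hkK' : (k : ℝ) ≤ K := by exact_mod_cast hkK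
  have hτ : 0 < T / K := by positivity
  rw [timeMeasure, Measure.restrict_congr_set Ioo_ae_eq_Ioc]
  refine Measure.restrict_mono (Ioc_subset_Ioc (mul_nonneg (by linarith) hτ.le) ?_) le_rfl
  calc (k : ℝ) * (T / K) ≤ K * (T / K) := by gcongr
    _ = T := by field_simp

theorem volume_timeInterval {τ : ℝ} (k : ℕ) : volume (timeInterval τ k) = ENNReal.ofReal τ := by
  rw [timeInterval, Real.volume_Ioc]
  congr 1
  ring

theorem le_inv_of_lt_tauZero {τ c₁ : ℝ} (hτ : 0 < τ) (hc₁ : 0 ≤ c₁)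
    (h : ENNReal.ofReal τ < tauZero c₁) : c₁ ≤ τ⁻¹ := by
  rcases hc₁.eq_or_lt with rfl | hpos
  · positivity
  have h4 : (4 : ℝ≥0∞) = ENNReal.ofReal 4 := by simp
  rw [tauZero, one_div, h4, ← ENNReal.ofReal_mul (by norm_num),
    ← ENNReal.ofReal_inv_of_pos (by positivity), ENNReal.ofReal_lt_ofReal_iff (by positivity)] at h
  rw [lt_inv_comm₀ hτ (by positivity)] at h
  linarith

end RotheGalerkin

theorem proposition5p1 {V H Y : Type*} {X : ℕ → Type*}
    [NormedAddCommGroup V] [NormedSpace ℝ V] [CompleteSpace V]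
    [NormedAddCommGroup H] [InnerProductSpace ℝ H] [CompleteSpace H]
    [NormedAddCommGroup Y] [InnerProductSpace ℝ Y] [CompleteSpace Y]
    [∀ n, NormedAddCommGroup (X n)] [∀ n, NormedSpace ℝ (X n)] [∀ n, CompleteSpace (X n)]
    (T p q c₀ c₁ c₂ : ℝ) (jV : V →L[ℝ] H) (jX : ∀ n, X n →L[ℝ] Y)
    (iH : H →ₗᵢ[ℝ] Y) (iX : ∀ n, V →ₗᵢ[ℝ] X n) (Vn : ∀ n, Submodule ℝ (X n))
    (v₀ : H) (v₀n : ∀ n, Vn n)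
    (f : ℝ → StrongDual ℝ V) (fn : ∀ n, ℝ → StrongDual ℝ (X n))
    (A : ℝ → V → StrongDual ℝ V) (An : ∀ n, ℝ → X n → StrongDual ℝ (X n))
    (hA : RotheGalerkin.StandingAssumption T p q c₀ c₁ c₂ jV jX iH iX Vn v₀ v₀n f fn A An) :
    ∀ K n : ℕ, 1 ≤ K → ENNReal.ofReal (T / K) < RotheGalerkin.tauZero c₁ →
      ∃ v : ℕ → Vn n,
        RotheGalerkin.IsRotheGalerkinSolution T K (jX n) (Vn n) (v₀n n) (fn n) (An n) v := by
  open RotheGalerkin in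
  intro K n hK hτ₀
  have hτ : 0 < T / K := div_pos hA.T_pos (by exact_mod_cast hK)
  have hp : 0 ≤ p := zero_le_one.trans hA.one_lt_p.le
  have hq : 0 ≤ q := hp.trans hA.p_le_q
  have hD := hA.discreteOperator
  obtain ⟨γ, lam, hγ, hlam, -, hgrowth⟩ := hD.an4
  have hbdd : ∀ r : ℝ, ∃ C : ℝ, ∀ᵐ s ∂(timeMeasure T), ∀ x, ‖x‖ ≤ r → ‖An n s x‖ ≤ C :=
    exists_bound_of_growth hp hq hlam.le hγ (hgrowth.mono fun s hs => hs n)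
  have hf : Integrable (fn n) (timeMeasure T) := by
    refine (hA.fn_memLp n).integrable ?_
    rw [dualExponent, ENNReal.one_le_ofReal, one_le_div (sub_pos.2 hA.one_lt_p)]
    linarith
  have hstep : ∀ k, 1 ≤ k → k ≤ K → ∀ a : Vn n, ∃ u : Vn n, ∀ w ∈ Vn n,
      inner ℝ ((T / K)⁻¹ • (jX n u - jX n a)) (jX n w)
        + operatorMean (T / K) k (An n) (u : X n) w = temporalMean (T / K) k (fn n) w := by
    intro k hk hkK a
    -- The mean over the time interval is the integral for the normalized Lebesgue measure.
    set μ := volume.restrict (timeInterval (T / K) k)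
    have hμuniv : μ univ = ENNReal.ofReal (T / K) := by
      rw [Measure.restrict_apply_univ, volume_timeInterval]
    have : IsFiniteMeasure μ := ⟨by rw [hμuniv]; exact ENNReal.ofReal_lt_top⟩
    have : NeZero μ := ⟨fun h => by simp [h, hτ.not_ge] at hμuniv⟩
    have hac : (μ univ)⁻¹ • μ ≪ timeMeasure T :=
      Measure.smul_absolutelyContinuous.trans
        (restrict_timeInterval_le hA.T_pos hk hkK).absolutelyContinuous
    obtain ⟨u, hu⟩ := exists_step_solution (ν := (μ univ)⁻¹ • μ) (A := An n)
      (hA.setting.triple_X n).reflexive (hA.approximation.isClosed n) (jX n) hA.one_lt_p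
      hD.c₀_pos (κ := (T / K)⁻¹) (by positivity) (le_inv_of_lt_tauZero hτ hD.c₁_nonneg hτ₀)
      (hac.ae_le (hD.an1_demicontinuous.mono fun s hs => hs n))
      (hac.ae_le (hD.an5.mono fun s hs => hs n))
      (fun x => (hD.an2 n x).mono_ac hac)
      (fun r => (hbdd r).imp fun C hC => hac.ae_le hC)
      (hac.ae_le (hD.an3.mono fun s hs => hs n))
      (temporalMean (T / K) k (fn n) + (T / K)⁻¹ • (innerSL ℝ (jX n a)).comp (jX n))
    refine ⟨u, fun w hw => ?_⟩
    have h := hu w hw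
    rw [inner_smul_left, inner_sub_left]
    change (T / K)⁻¹ * inner ℝ (jX n u) (jX n w) + operatorMean (T / K) k (An n) (u : X n) w
      = temporalMean (T / K) k (fn n) w + (T / K)⁻¹ * inner ℝ (jX n a) (jX n w) at h
    simp only [conj_trivial]
    linarith
  choose! step hstep using hstep
  refine ⟨fun k => Nat.rec (v₀n n) (fun i a => step (i + 1) a) k, rfl, fun k hk hkK => ?_,
    fun k hk hkK => ?_, fun k hk hkK w hw => ?_⟩
  · exact hf.mono_measure (restrict_timeInterval_le hA.T_pos hk hkK)
  · exact (integrable_of_ae_bound (hD.an2 n) hbdd _).mono_measure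
      (restrict_timeInterval_le hA.T_pos hk hkK)
  · obtain ⟨i, rfl⟩ := Nat.exists_eq_add_of_le' hk
    exact hstep (i + 1) hk hkK _ w hw
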